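/- Let $\tau$ be in the upper half-plane, $q=e^{2\pi i\tau}$, $\eta(\tau)=q^{1/24}\prod_{k\ge1}(1-q^k)$ and $\Delta(\tau)=\eta(\tau)^{24}$. For $a,b\in\mathbb R$ and $z\in\mathbb C$ put $$\vartheta\!\begin{bmatrix}a\\ b\end{bmatrix}(z,\tau)=\sum_{k\in\mathbb Z}\exp\bigl(i\pi(k+a)^2\tau+(k+a)(z+2\pi i b)\bigr),\qquad \vartheta_1(z)=\vartheta\!\begin{bmatrix}1/2\\ 1/2\end{bmatrix}(z,\tau).$$ Let $\Lambda=2\pi i(\mathbb Z+\mathbb Z\tau)$. For $\theta,\phi$ of absolute value $1$, let $P_1\!\begin{bmatrix}\theta\\ \phi\end{bmatrix}(z,\tau)$ be the meromorphic function of $z\in\mathbb C$, analytic outside $\Lambda$, that for $|q|<|e^z|<1$ is given by $$-\sum_{m}\frac{e^{mz}}{1-\theta^{-1}q^m},$$ where $q^m=e^{2\pi i\tau m}$ and $m$ runs over the real numbers with $e^{2\pi i m}=\phi$, the term $m=0$ being omitted if $(\theta,\phi)=(1,1)$. For $x,y\in\mathbb C^N$ put $$\Theta_{N}(x,y)=\frac{\prod_{1\le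 i,j\le N}\vartheta_1(x_i-y_j)}{\prod_{1\le i<k\le N}\vartheta_1(x_i-x_k)\,\prod_{1\le j<l\le N}\vartheta_1(y_j-y_l)},\qquad \mathbf P_N(\theta,\phi)=\Bigl[P_1\!\begin{bmatrix}\theta\\ \phi\end{bmatrix}(x_i-y_j,\tau)\Bigr]_{1\le i,j\le N},$$ and let $\mathbf Q_N$ be the $(N+1)\times(N+1)$ matrix obtained from $\mathbf P_N(1,1)$ by adding a last column and a last row of ones, with lower right corner entry $0$. Let $n\ge 0$ be an integer. (1) Let $\alpha,\beta\in\mathbb R$, $\theta=e^{-2\pi i\alpha}$, $\phi=e^{-2\pi i\beta}$ with $(\theta,\phi)\ne(1,1)$. Let $x_1,\dots,x_{8n},y_1,\dots,y_{8n}\in\mathbb C$ be pairwise incongruent modulo $\Lambda$ with $\vartheta\!\begin{bmatrix}1/2-\beta\\ 1/2+\alpha\end{bmatrix}\bigl(\sum_i(x_i-y_i),\tau\bigr)\neq0$. Then $$\Delta(\tau)^n=\frac{\vartheta\!\begin{bmatrix}1/2-\beta\\ 1/2+\alpha\end{bmatrix}(0,\tau)\;\Theta_{8n}(x,y)}{\vartheta\!\begin{bmatrix}1/2-\beta\\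 1/2+\alpha\end{bmatrix}\bigl(\sum_{i=1}^{8n}(x_i-y_i),\tau\bigr)}\,\det\mathbf P_{8n}(\theta,\phi).$$ (2) Let $x_1,\dots,x_{8n+1},y_1,\dots,y_{8n+1}\in\mathbb C$ be pairwise incongruent modulo $\Lambda$ with $\vartheta_1\bigl(\sum_i(x_i-y_i)\bigr)\ne0$. Then $$\Delta(\tau)^n=-\frac{\Theta_{8n+1}(x,y)}{\vartheta_1\bigl(\sum_{i=1}^{8n+1}(x_i-y_i)\bigr)}\,\det\mathbf Q_{8n+1}.$$ -/

import Mathlib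

open scoped UpperHalfPlane

noncomputable section

namespace GenGarvan

/-- The theta series with real characteristics `a`, `b`:
`ϑ[a; b](z, τ) = ∑_{n ∈ ℤ} exp (iπ (n + a)² τ + (n + a) (z + 2πi b))`. -/
def thetaChar (a b : ℝ) (z : ℂ) (τ : ℍ) : ℂ :=
  ∑' n : ℤ, Complex.exp
    (Complex.I * Real.pi * ((n : ℂ) + a) ^ 2 * τ
      + ((n : ℂ) + a) * (z + 2 * Real.pi * Complex.I * b))

/-- The odd theta function `ϑ[1/2; 1/2](z, τ)`. -/
def thetaOdd (z : ℂ) (τ : ℍ) : ℂ := thetaChar (1 / 2) (1 / 2) z τ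

/-- The lattice `2πi (ℤ + ℤ τ)` of the torus on which `z` is a coordinate. -/
def periodLattice (τ : ℍ) : Set ℂ :=
  {z | ∃ k m : ℤ, z = 2 * Real.pi * Complex.I * ((k : ℂ) + (m : ℂ) * τ)}

/-- The domain of convergence `|q| < |q_z| < 1`, with `q = exp (2πi τ)`, `q_z = exp z`. -/
def seriesDomain (τ : ℍ) : Set ℂ :=
  {z | ‖Complex.exp (2 * Real.pi * Complex.I * τ)‖ < ‖Complex.exp z‖ ∧ ‖Complex.exp z‖ < 1}

open Classical in
/-- The defining series `- ∑' q_z ^ n / (1 - θ⁻¹ q ^ n)` of the deformed Weierstrass function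
with characters `θ`, `φ`. The sum is over `n ∈ ℤ + λ`, where `φ = exp (2πi λ)`; that is, over the
real numbers `n` with `exp (2πi n) = φ`. The term `n = 0` is omitted if `(θ, φ) = (1, 1)`. -/
def deformedP1Series (θ φ : ℂ) (z : ℂ) (τ : ℍ) : ℂ :=
  -∑' n : {n : ℝ // Complex.exp (2 * Real.pi * Complex.I * n) = φ},
    if (n : ℝ) = 0 ∧ (θ, φ) = (1, 1) then 0
    else Complex.exp ((n : ℝ) * z) /
      (1 - θ⁻¹ * Complex.exp (2 * Real.pi * Complex.I * τ * (n : ℝ)))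

/-- `f` is the analytic continuation of the series to the complement of the period lattice.
Such an `f` is unique there, because that complement is connected. -/
def IsDeformedP1 (θ φ : ℂ) (τ : ℍ) (f : ℂ → ℂ) : Prop :=
  DifferentiableOn ℂ f (periodLattice τ)ᶜ ∧
    ∀ z ∈ seriesDomain τ, f z = deformedP1Series θ φ z τ

open Classical in
/-- The deformed Weierstrass function `P₁[θ; φ](z, τ)`: the meromorphic function of `z`, with poles
in the period lattice, whose values on `|q| < |q_z| < 1` are given by the series. -/
def deformedP1 (θ φ : ℂ) (z : ℂ) (τ : ℍ) : ℂ :=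
  if h : ∃ f : ℂ → ℂ, IsDeformedP1 θ φ τ f then h.choose z else 0

/-- The theta factor `Θ_{r, s, (m, n)}(x, y, τ)` with exponents `m i`, `n j`. -/
def thetaFactor {r s : ℕ} (m : Fin r → ℕ) (n : Fin s → ℕ)
    (x : Fin r → ℂ) (y : Fin s → ℂ) (τ : ℍ) : ℂ :=
  (∏ i, ∏ j, thetaOdd (x i - y j) τ ^ (m i * n j)) /
    ((∏ i, ∏ k ∈ Finset.Ioi i, thetaOdd (x i - x k) τ ^ (m i * m k)) *
      (∏ j, ∏ l ∈ Finset.Ioi j, thetaOdd (y j - y l) τ ^ (n j * n l)))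

/-- The `N × N` matrix `P_N(θ, φ) = [P₁[θ; φ](x_i - y_j, τ)]`. -/
def matrixP {N : ℕ} (θ φ : ℂ) (x y : Fin N → ℂ) (τ : ℍ) : Matrix (Fin N) (Fin N) ℂ :=
  Matrix.of fun i j => deformedP1 θ φ (x i - y j) τ

/-- The `(N + 1) × (N + 1)` matrix `Q_N`: the matrix `P_N(1, 1)` bordered by a column of ones and a
row of ones, with corner entry `0`. -/
def matrixQ {N : ℕ} (x y : Fin N → ℂ) (τ : ℍ) : Matrix (Fin N ⊕ Unit) (Fin N ⊕ Unit) ℂ :=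
  Matrix.fromBlocks (matrixP 1 1 x y τ) (Matrix.of fun _ _ => 1) (Matrix.of fun _ _ => 1) 0

/-- The points `x_i`, `y_j` are pairwise incongruent modulo the period lattice. -/
def GenericPoints {N : ℕ} (x y : Fin N → ℂ) (τ : ℍ) : Prop :=
  (∀ i j, x i - y j ∉ periodLattice τ) ∧
    (∀ i k, i ≠ k → x i - x k ∉ periodLattice τ) ∧
    (∀ j l, j ≠ l → y j - y l ∉ periodLattice τ)

end GenGarvan

end

noncomputable section

namespace GenGarvan

open Complex Filter Topology

/-! ### Theta series with characteristics -/

/-! Both identities are Frobenius' elliptic version of Cauchy's determinant, combined with Jacobi's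
derivative formula `ϑ₁'(0) = i η³`.

For `σ = ϑ₁`, the determinant of the matrix `σ(x_i - y_j + w) / σ(x_i - y_j)` of size `N`,
multiplied by `σ(w)`, equals `σ(w)^N σ(∑(x_i - y_i) + w)` times a product of Cauchy type
(`det_frobenius`). This follows by induction: after elimination of one row and column, the trisecant
identity `thetaOdd_trisecant` turns the Schur complement into a matrix of the same shape with
shifted `w`. The trisecant identity is itself a Plücker relation, because `ϑ₁(x + y) ϑ₁(x - y)` is a
2 × 2 determinant in theta functions of half the level. Letting `w → 0` gives the bordered
determinant of `σ'/σ` (`det_bordered_logDeriv`).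

The link to `P₁` is Liouville's argument on the torus. The defining series continues across `Re z =
0` with multipliers `φ`, `θ` and residue `1` at the origin. For nontrivial characters, `i η³
ϑ[1/2-β; 1/2+α](z) / (ϑ[1/2-β; 1/2+α](0) ϑ₁(z))` has the same properties; for trivial characters,
`ϑ₁'/ϑ₁` has the same additive defect. The difference is a constant
(`IsLambertCoeff.exists_hasSum`). A nontrivial multiplier forces it to be zero, and in the bordered
determinant a constant is invisible. The residue `i η³` and the zeros of `ϑ₁` come from the triple
product.

Thus each determinant carries `(i η³)^(8n) = η^(24n) = Δ^n`, and for these sizes the sign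
`(-1)^(N(N-1)/2)` is `1`. -/

lemma thetaChar_eq_jacobiTheta₂ (a b : ℝ) (z : ℂ) (τ : ℍ) :
    thetaChar a b z τ = cexp (I * Real.pi * a ^ 2 * τ + a * (z + 2 * Real.pi * I * b)) *
      jacobiTheta₂ (z / (2 * Real.pi * I) + b + a * τ) τ := by
  rw [thetaChar, jacobiTheta₂, ← tsum_mul_left]
  refine tsum_congr fun n => ?_
  rw [jacobiTheta₂_term, ← Complex.exp_add]
  congr 1
  field_simp [Complex.two_pi_I_ne_zero]
  ring

lemma differentiable_thetaChar (a b : ℝ) (τ : ℍ) :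
    Differentiable ℂ (fun z => thetaChar a b z τ) := by
  simp only [thetaChar_eq_jacobiTheta₂]
  refine Differentiable.mul (by fun_prop) fun z => ?_
  exact (differentiableAt_jacobiTheta₂_fst _ τ.im_pos).comp z
    (f := fun z => z / (2 * Real.pi * I) + b + a * τ) (by fun_prop)

lemma summable_thetaChar (a b : ℝ) (z : ℂ) (τ : ℍ) :
    Summable fun n : ℤ => cexp (I * Real.pi * ((n : ℂ) + a) ^ 2 * τ
      + ((n : ℂ) + a) * (z + 2 * Real.pi * I * b)) := by
  have h := ((summable_jacobiTheta₂_term_iff (z / (2 * Real.pi * I) + b + a * τ) τ).2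
    τ.im_pos).mul_left (cexp (I * Real.pi * a ^ 2 * τ + a * (z + 2 * Real.pi * I * b)))
  refine h.congr fun n => ?_
  rw [jacobiTheta₂_term, ← Complex.exp_add]
  congr 1
  field_simp [Complex.two_pi_I_ne_zero]
  ring

lemma thetaChar_add_two_pi_I (a b : ℝ) (z : ℂ) (τ : ℍ) :
    thetaChar a b (z + 2 * Real.pi * I) τ = cexp (2 * Real.pi * I * a) * thetaChar a b z τ := by
  rw [thetaChar, thetaChar, ← tsum_mul_left]
  refine tsum_congr fun n => ?_
  rw [← Complex.exp_add, Complex.exp_eq_exp_iff_exists_int]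
  exact ⟨n, by ring⟩

lemma thetaChar_add_tau (a b : ℝ) (z : ℂ) (τ : ℍ) :
    thetaChar a b (z + 2 * Real.pi * I * τ) τ =
      cexp (-(I * Real.pi * τ) - z - 2 * Real.pi * I * b) * thetaChar a b z τ := by
  rw [thetaChar, thetaChar, ← tsum_mul_left, ← (Equiv.addRight (1 : ℤ)).tsum_eq
    (fun n : ℤ => cexp (-(I * Real.pi * τ) - z - 2 * Real.pi * I * b) * _)]
  refine tsum_congr fun n => ?_
  rw [← Complex.exp_add]
  congr 1
  simp only [Equiv.coe_addRight]
  push_cast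
  ring

lemma thetaOdd_add_two_pi_I (z : ℂ) (τ : ℍ) :
    thetaOdd (z + 2 * Real.pi * I) τ = -thetaOdd z τ := by
  rw [thetaOdd, thetaChar_add_two_pi_I, thetaOdd,
    show 2 * (Real.pi : ℂ) * I * ((1 / 2 : ℝ) : ℂ) = Real.pi * I by push_cast; ring,
    Complex.exp_pi_mul_I]
  ring

lemma thetaOdd_add_tau (z : ℂ) (τ : ℍ) :
    thetaOdd (z + 2 * Real.pi * I * τ) τ =
      -cexp (-(I * Real.pi * τ) - z) * thetaOdd z τ := by
  rw [thetaOdd, thetaChar_add_tau, thetaOdd, Complex.exp_sub _ (_ * _),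
    show 2 * (Real.pi : ℂ) * I * ((1 / 2 : ℝ) : ℂ) = Real.pi * I by push_cast; ring,
    Complex.exp_pi_mul_I]
  ring

/-- The substitution `n ↦ -n - 1` negates `n + 1/2`; the sign is `exp (πi (2n + 1))` up to
inversion. -/
lemma thetaOdd_neg (z : ℂ) (τ : ℍ) : thetaOdd (-z) τ = -thetaOdd z τ := by
  rw [thetaOdd, thetaChar, thetaOdd, thetaChar, ← tsum_neg,
    ← ((Equiv.neg ℤ).trans (Equiv.addRight (-1 : ℤ))).tsum_eq]
  refine tsum_congr fun n => ?_
  rw [neg_eq_neg_one_mul (cexp _), ← Complex.exp_pi_mul_I, ← Complex.exp_add,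
    Complex.exp_eq_exp_iff_exists_int]
  refine ⟨-n - 1, ?_⟩
  simp only [Equiv.trans_apply, Equiv.neg_apply, Equiv.coe_addRight]
  push_cast
  ring

lemma thetaOdd_zero (τ : ℍ) : thetaOdd 0 τ = 0 := by
  have := thetaOdd_neg 0 τ
  rw [neg_zero] at this
  exact self_eq_neg.1 this

lemma differentiable_thetaOdd (τ : ℍ) : Differentiable ℂ (fun z => thetaOdd z τ) :=
  differentiable_thetaChar _ _ τ

/-- The argument shift which carries `ϑ₁` to the theta series with characteristics
`1/2 - β`, `1/2 + α`. -/
def charShift (α β : ℝ) (τ : ℍ) : ℂ := 2 * Real.pi * I * (α - β * τ)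

/-- This brings the theta quotient for `P₁` into Frobenius' form with `w = charShift α β τ`. The
factor `exp (-β z)` is multiplicative in `z = x_i - y_j`, so it leaves the determinant through rows
and columns. -/
lemma thetaChar_eq_thetaOdd_shift (α β : ℝ) (z : ℂ) (τ : ℍ) :
    thetaChar (1 / 2 - β) (1 / 2 + α) z τ =
      cexp (I * Real.pi * β ^ 2 * τ - β * (Real.pi * I + 2 * Real.pi * I * α)) *
        (cexp (-(β * z)) * thetaOdd (z + charShift α β τ) τ) := by
  rw [thetaOdd, thetaChar, thetaChar, ← tsum_mul_left, ← tsum_mul_left]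
  refine tsum_congr fun n => ?_
  rw [← Complex.exp_add, ← Complex.exp_add, charShift]
  congr 1
  push_cast
  ring

/-! ### The addition formula -/

/-- The even part `∑_{u even} exp (πi τ u² / 2 + u x)` of the theta series of half the level. -/
def thetaEven (τ : ℍ) (x : ℂ) : ℂ :=
  ∑' m : ℤ, cexp (I * Real.pi * τ * (2 * m) ^ 2 / 2 + 2 * m * x)

/-- The odd part `∑_{u odd} exp (πi τ u² / 2 + u x)` of the theta series of half the level. -/
def thetaUneven (τ : ℍ) (x : ℂ) : ℂ :=
  ∑' m : ℤ, cexp (I * Real.pi * τ * (2 * m + 1) ^ 2 / 2 + (2 * m + 1) * x)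

lemma summable_norm_thetaEven (τ : ℍ) (x : ℂ) :
    Summable fun m : ℤ => ‖cexp (I * Real.pi * τ * (2 * m) ^ 2 / 2 + 2 * m * x)‖ := by
  have hτ : 0 < (2 * (τ : ℂ)).im := by simpa using τ.im_pos
  have h := (summable_jacobiTheta₂_term_iff (x / (Real.pi * I)) (2 * τ)).2 hτ
  refine h.norm.congr fun n => ?_
  rw [jacobiTheta₂_term]
  congr 2
  field_simp
  ring

lemma summable_norm_thetaUneven (τ : ℍ) (x : ℂ) :
    Summable fun m : ℤ =>
      ‖cexp (I * Real.pi * τ * (2 * m + 1) ^ 2 / 2 + (2 * m + 1) * x)‖ := by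
  have h := (summable_norm_thetaEven τ (x + I * Real.pi * τ)).mul_left
    ‖cexp (I * Real.pi * τ / 2 + x)‖
  refine h.congr fun n => ?_
  rw [← norm_mul, ← Complex.exp_add]
  congr 2
  ring

/-- Pairs of integers, separated by the parity of their difference. -/
def parityEquiv : (ℤ × ℤ) ⊕ (ℤ × ℤ) ≃ ℤ × ℤ :=
  Equiv.ofBijective
    (Sum.elim (fun p => (p.1 + p.2, p.1 - p.2)) fun p => (p.1 + p.2, p.1 - p.2 - 1)) <| by
    constructor
    · rintro (⟨a, b⟩ | ⟨a, b⟩) (⟨c, d⟩ | ⟨c, d⟩) h <;>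
        simp only [Sum.elim_inl, Sum.elim_inr, Prod.mk.injEq] at h <;>
        first
          | (exfalso; omega)
          | (have h1 : a = c := by omega
             have h2 : b = d := by omega
             rw [h1, h2])
    · rintro ⟨k, l⟩
      rcases Int.even_or_odd' (k + l) with ⟨c, hc | hc⟩
      · exact ⟨Sum.inl (c, k - c), by simp only [Sum.elim_inl, Prod.mk.injEq]; omega⟩
      · exact ⟨Sum.inr (c + 1, k - (c + 1)), by
          simp only [Sum.elim_inr, Prod.mk.injEq]; omega⟩

lemma parityEquiv_inl (p : ℤ × ℤ) : parityEquiv (Sum.inl p) = (p.1 + p.2, p.1 - p.2) := rfl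

lemma parityEquiv_inr (p : ℤ × ℤ) : parityEquiv (Sum.inr p) = (p.1 + p.2, p.1 - p.2 - 1) := rfl

/-- In the double sum over `(k, l)` put `u = k + l + 1` and `v = k - l`. The exponent becomes `πi τ
(u² + v²) / 2 + u x + v y + πi u`, where `u` and `v` have opposite parity. Even `u` gives the first
product, odd `u` the second one with sign `-1`. -/
lemma thetaOdd_add_mul_thetaOdd_sub (τ : ℍ) (x y : ℂ) :
    thetaOdd (x + y) τ * thetaOdd (x - y) τ =
      thetaEven τ x * thetaUneven τ y - thetaUneven τ x * thetaEven τ y := by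
  have hs := fun z => (summable_thetaChar (1 / 2) (1 / 2) z τ).norm
  have hprod := summable_mul_of_summable_norm (hs (x + y)) (hs (x - y))
  rw [thetaOdd, thetaOdd, thetaChar, thetaChar,
    tsum_mul_tsum_of_summable_norm (hs (x + y)) (hs (x - y)), ← parityEquiv.tsum_eq,
    Summable.tsum_sum (by exact (parityEquiv.summable_iff.2 hprod).comp_injective Sum.inl_injective)
      (by exact (parityEquiv.summable_iff.2 hprod).comp_injective Sum.inr_injective),
    thetaEven, thetaUneven, thetaEven, thetaUneven,
    tsum_mul_tsum_of_summable_norm (summable_norm_thetaEven τ x) (summable_norm_thetaUneven τ y),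
    tsum_mul_tsum_of_summable_norm (summable_norm_thetaUneven τ x) (summable_norm_thetaEven τ y),
    add_comm, sub_eq_add_neg (∑' _, _), ← tsum_neg]
  congr 1
  · refine tsum_congr fun p => ?_
    rw [← Complex.exp_add, ← Complex.exp_add, Complex.exp_eq_exp_iff_exists_int]
    refine ⟨p.1, ?_⟩
    simp only [parityEquiv_inr]
    push_cast
    ring
  · refine tsum_congr fun p => ?_
    rw [← Complex.exp_add, ← Complex.exp_add, ← neg_one_mul, ← Complex.exp_pi_mul_I,
      ← Complex.exp_add, Complex.exp_eq_exp_iff_exists_int]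
    refine ⟨p.1, ?_⟩
    simp only [parityEquiv_inl]
    push_cast
    ring

/-- The trisecant identity for `ϑ₁`. -/
lemma thetaOdd_trisecant (τ : ℍ) (w p r s t : ℂ) (h : p + r = s + t) :
    thetaOdd (p + w) τ * thetaOdd (r + w) τ * (thetaOdd s τ * thetaOdd t τ) -
        thetaOdd (s + w) τ * thetaOdd (t + w) τ * (thetaOdd p τ * thetaOdd r τ) =
      thetaOdd w τ * thetaOdd (p + r + w) τ * (thetaOdd (p - t) τ * thetaOdd (p - s) τ) := by
  obtain rfl : t = p + r - s := by rw [h]; ring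
  have e (a b x y : ℂ) (ha : a = x + y) (hb : b = x - y) : thetaOdd a τ * thetaOdd b τ =
      thetaEven τ x * thetaUneven τ y - thetaUneven τ x * thetaEven τ y := by
    rw [ha, hb, thetaOdd_add_mul_thetaOdd_sub]
  -- With `[X, Y]` the 2 × 2 determinant of even and odd parts at two points, the claim is the
  -- Plücker relation `[A,B][C,D] - [A,D][C,B] = [A,C][B,D]` for `A = (p+r)/2 + w`, `B = (p-r)/2`,
  -- `C = (p+r)/2`, `D = s - (p+r)/2`.
  rw [e (p + w) (r + w) ((p + r) / 2 + w) ((p - r) / 2) (by ring) (by ring),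
    e s (p + r - s) ((p + r) / 2) (s - (p + r) / 2) (by ring) (by ring),
    e (s + w) (p + r - s + w) ((p + r) / 2 + w) (s - (p + r) / 2) (by ring) (by ring),
    e p r ((p + r) / 2) ((p - r) / 2) (by ring) (by ring),
    mul_comm (thetaOdd w τ), e (p + r + w) w ((p + r) / 2 + w) ((p + r) / 2) (by ring) (by ring),
    e (p - (p + r - s)) (p - s) ((p - r) / 2) (s - (p + r) / 2) (by ring) (by ring)]
  ring

/-! ### Determinants of theta quotients -/

/-- Elimination of the first row and column with a nonzero pivot. -/
lemma det_eq_pivot_mul_det {K : Type*} [Field K] {N : ℕ}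
    (A : Matrix (Fin (N + 1)) (Fin (N + 1)) K) (h : A 0 0 ≠ 0) :
    A.det = A 0 0 * (Matrix.of fun i j : Fin N =>
      A i.succ j.succ - A i.succ 0 * A 0 j.succ / A 0 0).det := by
  have e : A.det =
      (Matrix.of fun i j => A i j - (if i = 0 then 0 else A i 0 / A 0 0) * A 0 j).det := by
    refine Matrix.det_eq_of_forall_row_eq_smul_add_const
      (fun i => if i = 0 then 0 else A i 0 / A 0 0) 0 (by simp) fun i j => ?_
    simp
  rw [e, Matrix.det_succ_column_zero, Fin.sum_univ_succ, Finset.sum_eq_zero]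
  · simp only [Fin.val_zero, pow_zero, Matrix.of_apply, if_true, zero_mul, sub_zero, one_mul,
      add_zero, Fin.succAbove_zero]
    congr 2
    ext i j
    simp only [Matrix.submatrix_apply, Matrix.of_apply, if_neg (Fin.succ_ne_zero _)]
    ring
  · intro i _
    simp [h]

lemma det_of_scaled {K : Type*} [CommRing K] {n : Type*} [Fintype n] [DecidableEq n] (c : K)
    (u v : n → K) (M : Matrix n n K) :
    (Matrix.of fun i j => c * u i * v j * M i j).det =
      c ^ Fintype.card n * (∏ i, u i) * (∏ i, v i) * M.det := by
  have : (Matrix.of fun i j => c * u i * v j * M i j) =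
      c • (Matrix.diagonal u * M * Matrix.diagonal v) := by
    ext i j
    simp only [Matrix.of_apply, Matrix.smul_apply, Matrix.mul_diagonal, Matrix.diagonal_mul,
      smul_eq_mul]
    ring
  rw [this, Matrix.det_smul, Matrix.det_mul, Matrix.det_mul, Matrix.det_diagonal,
    Matrix.det_diagonal]
  ring

/-- The quotient of products of values of `σ` in the determinant formula of Frobenius. -/
def cauchyQuotient (σ : ℂ → ℂ) {N : ℕ} (x y : Fin N → ℂ) : ℂ :=
  (∏ i, ∏ k ∈ Finset.Ioi i, σ (x i - x k) * σ (y k - y i)) / ∏ i, ∏ j, σ (x i - y j)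

/-- The two products over `i` are the row and column factors extracted by the elimination in
`det_frobenius`. -/
lemma cauchyQuotient_succ (σ : ℂ → ℂ) {N : ℕ} (x y : Fin (N + 1) → ℂ) :
    cauchyQuotient σ x y = (∏ i : Fin N, σ (x 0 - x i.succ) / σ (x i.succ - y 0)) *
      (∏ i : Fin N, σ (y i.succ - y 0) / σ (x 0 - y i.succ)) / σ (x 0 - y 0) *
      cauchyQuotient σ (fun i => x i.succ) (fun i => y i.succ) := by
  simp only [cauchyQuotient, Fin.prod_univ_succ, Fin.prod_Ioi_zero, Fin.prod_Ioi_succ,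
    Finset.prod_mul_distrib, div_eq_mul_inv, mul_inv, Finset.prod_inv_distrib]
  ring

/-- The trisecant identity for a function `σ`. -/
def IsTrisecant (σ : ℂ → ℂ) : Prop :=
  ∀ w p r s t, p + r = s + t → σ (p + w) * σ (r + w) * (σ s * σ t) -
    σ (s + w) * σ (t + w) * (σ p * σ r) = σ w * σ (p + r + w) * (σ (p - t) * σ (p - s))

/-- The determinant formula of Frobenius, for a function with the trisecant identity. -/
theorem det_frobenius {σ : ℂ → ℂ} (hfay : IsTrisecant σ) (hc : Continuous σ)
    (hd : Dense {z | σ z ≠ 0}) {N : ℕ} (x y : Fin N → ℂ)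
    (hxy : ∀ i j, σ (x i - y j) ≠ 0) (w : ℂ) :
    σ w * (Matrix.of fun i j => σ (x i - y j + w) / σ (x i - y j)).det =
      σ w ^ N * σ (∑ i, (x i - y i) + w) * cauchyQuotient σ x y := by
  induction N generalizing w with
  | zero => simp [cauchyQuotient]
  | succ N ih =>
    -- The pivot is nonzero only for `w` in a dense set; both sides are continuous in `w`, so this
    -- suffices.
    have hd' : Dense {w | σ (w + (x 0 - y 0)) ≠ 0} :=
      hd.preimage (Homeomorph.addRight (x 0 - y 0)).isOpenMap
    refine congrFun (Continuous.ext_on hd' (f := fun w => σ w *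
      (Matrix.of fun i j => σ (x i - y j + w) / σ (x i - y j)).det)
      (g := fun w => σ w ^ (N + 1) * σ (∑ i, (x i - y i) + w) * cauchyQuotient σ x y)
      ?_ ?_ ?_) w
    · refine hc.mul (Continuous.matrix_det ?_)
      refine continuous_matrix fun i j => ?_
      simp only [Matrix.of_apply]
      fun_prop
    · fun_prop
    · intro w hw
      simp only [Set.mem_ofPred_eq] at hw
      have hw' : σ (x 0 - y 0 + w) ≠ 0 := by rwa [add_comm]
      have ih' := ih (fun i => x i.succ) (fun i => y i.succ) (fun i j => hxy _ _)
        (w + (x 0 - y 0))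
      simp only
      rw [det_eq_pivot_mul_det _ (by simpa using ⟨hw', hxy 0 0⟩)]
      -- By the trisecant identity the Schur complement is again of Frobenius' form, with `w`
      -- replaced by `w + (x 0 - y 0)`, up to row and column factors.
      have hM : (Matrix.of fun i j : Fin N =>
          (Matrix.of fun i j => σ (x i - y j + w) / σ (x i - y j)) i.succ j.succ -
          (Matrix.of fun i j => σ (x i - y j + w) / σ (x i - y j)) i.succ 0 *
          (Matrix.of fun i j => σ (x i - y j + w) / σ (x i - y j)) 0 j.succ /
          (Matrix.of fun i j => σ (x i - y j + w) / σ (x i - y j)) 0 0) =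
          Matrix.of fun i j : Fin N => σ w / σ (w + (x 0 - y 0)) *
            (σ (x 0 - x i.succ) / σ (x i.succ - y 0)) * (σ (y j.succ - y 0) / σ (x 0 - y j.succ)) *
            (Matrix.of fun i j : Fin N => σ (x i.succ - y j.succ + (w + (x 0 - y 0))) /
              σ (x i.succ - y j.succ)) i j := by
        ext i j
        simp only [Matrix.of_apply]
        have h1 := hxy i.succ j.succ
        have h2 := hxy 0 0
        have h3 := hxy i.succ 0
        have h4 := hxy 0 j.succ
        have f := hfay w (x 0 - y 0) (x i.succ - y j.succ) (x i.succ - y 0) (x 0 - y j.succ)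
          (by ring)
        rw [show x 0 - y 0 - (x 0 - y j.succ) = y j.succ - y 0 by ring,
          show x 0 - y 0 - (x i.succ - y 0 ) = x 0 - x i.succ by ring,
          show x 0 - y 0 + (x i.succ - y j.succ) + w =
            x i.succ - y j.succ + (w + (x 0 - y 0)) by ring] at f
        rw [add_comm w (x 0 - y 0)] at f ⊢
        field_simp
        linear_combination f
      rw [hM, det_of_scaled, cauchyQuotient_succ, Fin.sum_univ_succ, Fintype.card_fin,
        show x 0 - y 0 + ∑ i : Fin N, (x i.succ - y i.succ) + w =
          ∑ i : Fin N, (x i.succ - y i.succ) + (w + (x 0 - y 0)) by ring]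
      simp only [Matrix.of_apply, add_comm (x 0 - y 0) w]
      have h2 := hxy 0 0
      calc _ = σ w * (σ w / σ (w + (x 0 - y 0))) ^ N / σ (x 0 - y 0) *
            (∏ i : Fin N, σ (x 0 - x i.succ) / σ (x i.succ - y 0)) *
            (∏ i : Fin N, σ (y i.succ - y 0) / σ (x 0 - y i.succ)) *
            (σ (w + (x 0 - y 0)) * (Matrix.of fun i j : Fin N =>
              σ (x i.succ - y j.succ + (w + (x 0 - y 0))) / σ (x i.succ - y j.succ)).det) := by
              ring
        _ = _ := by
          rw [ih', div_pow]
          field_simp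
          ring

/-- The Schur complement of the corner `-w` is `M + w⁻¹ = w⁻¹ (1 + w M)`, entrywise. Bordering makes
the order of vanishing `w ^ N` explicit before the limit `w → 0`. -/
lemma det_one_add_smul_eq_bordered {K : Type*} [Field K] {N : ℕ} (w : K) (hw : w ≠ 0)
    (M : Matrix (Fin (N + 1)) (Fin (N + 1)) K) :
    (Matrix.of fun i j => 1 + w * M i j).det = -w ^ N *
      (Matrix.fromBlocks M (Matrix.of fun _ _ => 1) (Matrix.of fun _ _ => 1)
        (Matrix.of fun _ _ => -w) : Matrix (Fin (N + 1) ⊕ Unit) (Fin (N + 1) ⊕ Unit) K).det := by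
  let _ : Invertible (Matrix.of fun _ _ => -w : Matrix Unit Unit K) :=
    ⟨Matrix.of fun _ _ => -w⁻¹, by ext i j; simp [Matrix.mul_apply, hw],
      by ext i j; simp [Matrix.mul_apply, hw]⟩
  rw [Matrix.det_fromBlocks₂₂]
  have : M - (Matrix.of fun _ _ => 1 : Matrix (Fin (N + 1)) Unit K) *
      ⅟(Matrix.of fun _ _ => -w : Matrix Unit Unit K) *
      (Matrix.of fun _ _ => 1 : Matrix Unit (Fin (N + 1)) K) =
      w⁻¹ • Matrix.of fun i j => 1 + w * M i j := by
    ext i j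
    have : ⅟(Matrix.of fun _ _ => -w : Matrix Unit Unit K) = Matrix.of fun _ _ => -w⁻¹ := rfl
    rw [this]
    simp only [Matrix.sub_apply, Matrix.mul_apply, Matrix.of_apply, Matrix.smul_apply, smul_eq_mul,
      Finset.univ_unique, Finset.sum_singleton]
    field_simp
    ring
  rw [this, Matrix.det_smul, Fintype.card_fin]
  simp only [Matrix.det_unique, Matrix.of_apply]
  field_simp
  rw [one_div, inv_pow]
  field_simp
  ring

/-- The limit `w → 0` of the determinant formula of Frobenius. -/
theorem det_bordered_logDeriv {σ : ℂ → ℂ} (hfay : IsTrisecant σ)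
    (hσ : Differentiable ℂ σ) (hd : Dense {z | σ z ≠ 0}) (h0 : σ 0 = 0)
    (h0' : deriv σ 0 ≠ 0) {N : ℕ} (x y : Fin (N + 1) → ℂ) (hxy : ∀ i j, σ (x i - y j) ≠ 0) :
    (Matrix.fromBlocks (Matrix.of fun i j => deriv σ (x i - y j) / σ (x i - y j))
      (Matrix.of fun _ _ => 1) (Matrix.of fun _ _ => 1) 0 :
        Matrix (Fin (N + 1) ⊕ Unit) (Fin (N + 1) ⊕ Unit) ℂ).det =
      -(deriv σ 0 ^ N * σ (∑ i, (x i - y i)) * cauchyQuotient σ x y) := by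
  have hslope (z : ℂ) : Tendsto (fun w => (σ (z + w) - σ z) / w) (𝓝[≠] 0) (𝓝 (deriv σ z)) := by
    have := (hσ z).hasDerivAt.tendsto_slope_zero
    refine this.congr fun w => ?_
    rw [smul_eq_mul]
    ring
  -- Frobenius' entries are `1 + w` times a difference quotient divided by `σ(x_i - y_j)`. After
  -- bordering with corner `-w`, all entries have limits.
  have hL : Tendsto (fun w => (Matrix.fromBlocks
      (Matrix.of fun i j => (σ (x i - y j + w) - σ (x i - y j)) / w / σ (x i - y j))
      (Matrix.of fun _ _ => 1) (Matrix.of fun _ _ => 1) (Matrix.of fun _ _ => -w) :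
        Matrix (Fin (N + 1) ⊕ Unit) (Fin (N + 1) ⊕ Unit) ℂ).det) (𝓝[≠] 0)
      (𝓝 (Matrix.fromBlocks (Matrix.of fun i j => deriv σ (x i - y j) / σ (x i - y j))
      (Matrix.of fun _ _ => 1) (Matrix.of fun _ _ => 1) 0 :
        Matrix (Fin (N + 1) ⊕ Unit) (Fin (N + 1) ⊕ Unit) ℂ).det) := by
    refine ((continuous_id.matrix_det).tendsto _).comp ?_
    refine tendsto_pi_nhds.2 fun i => tendsto_pi_nhds.2 fun j => ?_
    rcases i with i | i <;> rcases j with j | j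
    · exact (hslope _).div_const _
    · exact tendsto_const_nhds
    · exact tendsto_const_nhds
    · have : Tendsto (fun w : ℂ => -w) (𝓝[≠] 0) (𝓝 (-0)) :=
        (continuous_neg.tendsto 0).mono_left nhdsWithin_le_nhds
      simpa using this
  have hR : Tendsto (fun w => -((σ w / w) ^ N * σ (∑ i, (x i - y i) + w) * cauchyQuotient σ x y))
      (𝓝[≠] 0) (𝓝 (-(deriv σ 0 ^ N * σ (∑ i, (x i - y i)) * cauchyQuotient σ x y))) := by
    refine (((Tendsto.pow ?_ N).mul ?_).mul_const _).neg
    · simpa [h0] using hslope 0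
    · have hc : Continuous fun w => σ (∑ i, (x i - y i) + w) := hσ.continuous.comp (by fun_prop)
      simpa using (hc.tendsto 0).mono_left (nhdsWithin_le_nhds (s := {0}ᶜ))
  refine tendsto_nhds_unique (hL.congr' ?_) hR
  have hne : ∀ᶠ w in 𝓝[≠] (0 : ℂ), σ w ≠ 0 :=
    (hσ 0).hasDerivAt.eventually_ne h0'
  filter_upwards [hne, self_mem_nhdsWithin] with w hw hw0
  have hw0 : w ≠ 0 := hw0
  have h1 := det_frobenius hfay hσ.continuous hd x y hxy w
  have h2 := det_one_add_smul_eq_bordered w hw0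
    (Matrix.of fun i j => (σ (x i - y j + w) - σ (x i - y j)) / w / σ (x i - y j))
  have h3 : (Matrix.of fun i j => 1 + w * (Matrix.of fun i j =>
      (σ (x i - y j + w) - σ (x i - y j)) / w / σ (x i - y j)) i j) =
      Matrix.of fun i j => σ (x i - y j + w) / σ (x i - y j) := by
    ext i j
    have := hxy i j
    simp only [Matrix.of_apply]
    field_simp
    ring
  rw [h3] at h2
  rw [h2, pow_succ] at h1
  have h4 : w ^ N ≠ 0 := pow_ne_zero _ hw0
  rw [div_pow]
  generalize (Matrix.fromBlocks _ _ _ _ : Matrix (Fin (N + 1) ⊕ Unit) (Fin (N + 1) ⊕ Unit) ℂ).det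
    = D at h1 ⊢
  field_simp
  refine mul_left_cancel₀ hw ?_
  linear_combination -h1

/-- A column operation: `c` times the bordering column of ones is added to the other columns. Hence
the additive constant in `P₁[1; 1]` need not be computed. -/
lemma det_bordered_add_const {K : Type*} [CommRing K] {n : Type*} [Fintype n] [DecidableEq n]
    (c : K) (M : Matrix n n K) :
    (Matrix.fromBlocks (Matrix.of fun i j => M i j + c) (Matrix.of fun _ _ => 1)
      (Matrix.of fun _ _ => 1) 0 : Matrix (n ⊕ Unit) (n ⊕ Unit) K).det =
    (Matrix.fromBlocks M (Matrix.of fun _ _ => 1)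
      (Matrix.of fun _ _ => 1) 0 : Matrix (n ⊕ Unit) (n ⊕ Unit) K).det := by
  have : (Matrix.fromBlocks (Matrix.of fun i j => M i j + c) (Matrix.of fun _ _ => 1)
      (Matrix.of fun _ _ => 1) 0 : Matrix (n ⊕ Unit) (n ⊕ Unit) K) =
      Matrix.fromBlocks M (Matrix.of fun _ _ => 1) (Matrix.of fun _ _ => 1) 0 *
        Matrix.fromBlocks 1 0 (Matrix.of fun _ _ => c) 1 := by
    rw [Matrix.fromBlocks_multiply]
    congr 1 <;> ext i j <;> simp [Matrix.mul_apply]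
  rw [this, Matrix.det_mul, Matrix.det_fromBlocks_zero₁₂]
  simp

/-! ### The triple product -/

/-- The finite product `∏_{k=1}^m (1 - q^k)`. -/
def eulerProd (q : ℂ) (m : ℕ) : ℂ := ∏ k ∈ Finset.range m, (1 - q ^ (k + 1))

lemma eulerProd_succ (q : ℂ) (m : ℕ) : eulerProd q (m + 1) = eulerProd q m * (1 - q ^ (m + 1)) :=
  Finset.prod_range_succ _ _

lemma one_sub_pow_ne_zero {q : ℂ} (hq : ‖q‖ < 1) (k : ℕ) : 1 - q ^ (k + 1) ≠ 0 := by
  intro h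
  have : ‖q‖ ^ (k + 1) < 1 := pow_lt_one₀ (norm_nonneg _) hq (by omega)
  rw [← norm_pow, ← sub_eq_zero.1 h, norm_one] at this
  exact lt_irrefl _ this

lemma eulerProd_ne_zero {q : ℂ} (hq : ‖q‖ < 1) (m : ℕ) : eulerProd q m ≠ 0 :=
  Finset.prod_ne_zero_iff.2 fun k _ => one_sub_pow_ne_zero hq k

/-- The finite `q`-binomial theorem. -/
lemma prod_one_add_pow_mul {q : ℂ} (hq : ‖q‖ < 1) (x : ℂ) (M : ℕ) :
    ∏ k ∈ Finset.range M, (1 + q ^ k * x) = ∑ j ∈ Finset.range (M + 1),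
      eulerProd q M / (eulerProd q j * eulerProd q (M - j)) * (q ^ j.choose 2 * x ^ j) := by
  have ha := eulerProd_ne_zero hq
  induction M with
  | zero => simp [eulerProd]
  | succ M ih =>
    rw [Finset.prod_range_succ, ih, mul_add, mul_one, Finset.sum_range_succ' _ (M + 1),
      Finset.sum_range_succ _ M]
    nth_rw 1 [← Finset.sum_range_succ, Finset.sum_range_succ']
    rw [Finset.sum_range_succ _ M]
    -- The `q`-Pascal rule for the exponents `1, …, M`; the exponents `0` and `M + 1` have been
    -- split off.
    have h : ∑ j ∈ Finset.range M, eulerProd q (M + 1) /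
        (eulerProd q (j + 1) * eulerProd q (M + 1 - (j + 1))) *
          (q ^ (j + 1).choose 2 * x ^ (j + 1)) =
        ∑ j ∈ Finset.range M, eulerProd q M / (eulerProd q (j + 1) * eulerProd q (M - (j + 1))) *
          (q ^ (j + 1).choose 2 * x ^ (j + 1)) +
        (∑ j ∈ Finset.range M, eulerProd q M / (eulerProd q j * eulerProd q (M - j)) *
          (q ^ j.choose 2 * x ^ j)) * (q ^ M * x) := by
      rw [Finset.sum_mul, ← Finset.sum_add_distrib]
      refine Finset.sum_congr rfl fun j hj => ?_
      obtain ⟨d, rfl⟩ : ∃ d, M = j + 1 + d := Nat.exists_eq_add_of_le (Finset.mem_range.1 hj)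
      rw [show j + 1 + d + 1 - (j + 1) = d + 1 by omega, show j + 1 + d - (j + 1) = d by omega,
        show j + 1 + d - j = d + 1 by omega, eulerProd_succ q (j + 1 + d), eulerProd_succ q j,
        eulerProd_succ q d, show (j + 1).choose 2 = j + j.choose 2 by
          rw [Nat.choose_succ_succ, Nat.choose_one_right]]
      have h1 := ha j
      have h2 := ha d
      have h3 := one_sub_pow_ne_zero hq j
      have h4 := one_sub_pow_ne_zero hq d
      field_simp
      ring
    have hM : (M + 1).choose 2 = M + M.choose 2 := by
      rw [Nat.choose_succ_succ, Nat.choose_one_right]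
    have e0 : eulerProd q 0 = 1 := by simp [eulerProd]
    have h1 := ha M
    have h2 := ha (M + 1)
    rw [h, hM]
    simp only [Nat.sub_self, Nat.sub_zero, e0, mul_one, one_mul, div_self h1, div_self h2]
    ring

/-- The general term `(-1)^i q^(i(i-1)/2) e^(-iz)` of the triple product series. -/
def tripleTerm (τ : ℍ) (z : ℂ) (i : ℤ) : ℂ :=
  cexp (Real.pi * I * τ * ((i : ℂ) ^ 2 - i) + i * (Real.pi * I - z))

lemma summable_norm_tripleTerm_and_thetaOdd_eq (τ : ℍ) (z : ℂ) :
    (Summable fun i => ‖tripleTerm τ z i‖) ∧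
      thetaOdd z τ = cexp (I * Real.pi * τ / 4 + (z + Real.pi * I) / 2) * ∑' i, tripleTerm τ z i := by
  have key (i : ℤ) : cexp (I * Real.pi * (((-i : ℤ) : ℂ) + (1 / 2 : ℝ)) ^ 2 * τ
      + (((-i : ℤ) : ℂ) + (1 / 2 : ℝ)) * (z + 2 * Real.pi * I * (1 / 2 : ℝ))) =
      cexp (I * Real.pi * τ / 4 + (z + Real.pi * I) / 2) * tripleTerm τ z i := by
    rw [tripleTerm, ← Complex.exp_add, Complex.exp_eq_exp_iff_exists_int]
    refine ⟨-i, ?_⟩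
    push_cast
    ring
  constructor
  · have h := ((Equiv.neg ℤ).summable_iff.2 (summable_thetaChar (1 / 2) (1 / 2) z τ)).congr key
    exact ((summable_mul_left_iff (Complex.exp_ne_zero _)).1 h).norm
  · rw [thetaOdd, thetaChar, ← (Equiv.neg ℤ).tsum_eq, ← tsum_mul_left]
    exact tsum_congr key

/-- The finite triple product. -/
lemma prod_mul_prod_eq_sum_tripleTerm (τ : ℍ) (z : ℂ) (N : ℕ) {q : ℂ}
    (hq : q = cexp (2 * Real.pi * I * τ)) (hq1 : ‖q‖ < 1) :
    (∏ k ∈ Finset.range N, (1 - q ^ k * cexp (-z))) *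
        (∏ k ∈ Finset.range N, (1 - q ^ (k + 1) * cexp z)) =
      ∑ j ∈ Finset.range (2 * N + 1), eulerProd q (2 * N) /
        (eulerProd q j * eulerProd q (2 * N - j)) * tripleTerm τ z (j - N) := by
  have hqk (k : ℕ) : q ^ k = cexp (k * (2 * Real.pi * I * τ)) := by rw [hq, ← Complex.exp_nat_mul]
  -- The `q`-binomial theorem is used with `2N` factors at `-q^(-N) e^(-z)`. The first `N` factors
  -- are `1 - q^(-j) e^(-z) = -q^(-j) e^(-z) (1 - q^j e^z)` for `1 ≤ j ≤ N`; the others are already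
  -- of the desired form.
  have hprod : ∏ k ∈ Finset.range N, (1 + q ^ k * cexp (Real.pi * I - z - N * (2 * Real.pi * I * τ)))
      = cexp (N * (Real.pi * I - z) - Real.pi * I * τ * (N * (N + 1))) *
        ∏ k ∈ Finset.range N, (1 - q ^ (k + 1) * cexp z) := by
    have hE : cexp (N * (Real.pi * I - z) - Real.pi * I * τ * (N * (N + 1))) =
        ∏ k ∈ Finset.range N, cexp ((Real.pi * I - z) - (k + 1) * (2 * Real.pi * I * τ)) := by
      rw [← Complex.exp_sum, Finset.sum_sub_distrib, Finset.sum_const, Finset.card_range,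
        ← Finset.sum_mul]
      have : ∑ k ∈ Finset.range N, ((k : ℂ) + 1) = N * (N + 1) / 2 := by
        clear * -
        induction N with
        | zero => simp
        | succ n ih => rw [Finset.sum_range_succ, ih]; push_cast; ring
      rw [this, nsmul_eq_mul]
      congr 1
      ring
    rw [hE, ← Finset.prod_mul_distrib, ← Finset.prod_range_reflect]
    refine Finset.prod_congr rfl fun k hk => ?_
    have hk' := Finset.mem_range.1 hk
    have e1 : q ^ (N - 1 - k) * cexp (Real.pi * I - z - N * (2 * Real.pi * I * τ)) =
        cexp ((Real.pi * I - z) - (k + 1) * (2 * Real.pi * I * τ)) := by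
      rw [hqk, ← Complex.exp_add, Nat.cast_sub (by omega), Nat.cast_sub (by omega)]
      congr 1
      push_cast
      ring
    have e2 : cexp ((Real.pi * I - z) - (k + 1) * (2 * Real.pi * I * τ)) *
        (q ^ (k + 1) * cexp z) = -1 := by
      rw [hqk, ← Complex.exp_add, ← Complex.exp_add, ← Complex.exp_pi_mul_I]
      congr 1
      push_cast
      ring
    rw [e1, mul_sub, e2]
    ring
  have hprod2 : ∏ k ∈ Finset.range N,
      (1 + q ^ (N + k) * cexp (Real.pi * I - z - N * (2 * Real.pi * I * τ))) =
      ∏ k ∈ Finset.range N, (1 - q ^ k * cexp (-z)) := by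
    refine Finset.prod_congr rfl fun k _ => ?_
    have e1 : q ^ (N + k) * cexp (Real.pi * I - z - N * (2 * Real.pi * I * τ)) =
        -1 * (q ^ k * cexp (-z)) := by
      rw [hqk, hqk, ← Complex.exp_pi_mul_I, ← Complex.exp_add, ← Complex.exp_add,
        ← Complex.exp_add]
      congr 1
      push_cast
      ring
    rw [e1]
    ring
  have h := prod_one_add_pow_mul hq1 (cexp (Real.pi * I - z - N * (2 * Real.pi * I * τ))) (2 * N)
  rw [two_mul, Finset.prod_range_add, hprod, hprod2, ← two_mul] at h
  refine mul_left_cancel₀ (Complex.exp_ne_zero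
    (N * (Real.pi * I - z) - Real.pi * I * τ * (N * (N + 1)))) ?_
  rw [mul_comm (∏ k ∈ _, _), ← mul_assoc, h, Finset.mul_sum]
  refine Finset.sum_congr rfl fun j _ => ?_
  have hj : ((j.choose 2 : ℕ) : ℂ) = j * (j - 1) / 2 := Nat.cast_choose_two ℂ j
  rw [mul_left_comm (cexp _), tripleTerm, ← Complex.exp_add, hqk, ← Complex.exp_nat_mul,
    ← Complex.exp_add, hj]
  congr 2
  push_cast
  ring

lemma norm_nome_lt_one (τ : ℍ) : ‖cexp (2 * Real.pi * I * τ)‖ < 1 :=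
  UpperHalfPlane.norm_exp_two_pi_I_lt_one τ

lemma multipliable_one_sub_pow_mul {q : ℂ} (hq : ‖q‖ < 1) (v : ℂ) :
    Multipliable fun k : ℕ => 1 - q ^ k * v := by
  simp only [sub_eq_add_neg]
  refine multipliable_one_add_of_summable ?_
  simpa [norm_neg, norm_mul, norm_pow] using
    (summable_geometric_of_lt_one (norm_nonneg _) hq).mul_right ‖v‖

lemma tendsto_eulerProd {q : ℂ} (hq : ‖q‖ < 1) :
    Tendsto (eulerProd q) atTop (𝓝 (∏' k : ℕ, (1 - q ^ (k + 1)))) :=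
  (ModularForm.multipliable_one_sub_pow hq).hasProd.tendsto_prod_nat

lemma tprod_one_sub_pow_mul_ne_zero {q : ℂ} (hq : ‖q‖ < 1) {v : ℂ}
    (hv : ∀ k : ℕ, 1 - q ^ (k + 1) * v ≠ 0) : ∏' k : ℕ, (1 - q ^ (k + 1) * v) ≠ 0 := by
  simp only [sub_eq_add_neg] at hv ⊢
  refine tprod_one_add_ne_zero_of_summable hv ?_
  simpa [norm_neg, norm_mul, norm_pow] using
    ((summable_nat_add_iff 1).2 (summable_geometric_of_lt_one (norm_nonneg _) hq)).mul_right ‖v‖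

lemma tprod_one_sub_pow_ne_zero {q : ℂ} (hq : ‖q‖ < 1) : ∏' k : ℕ, (1 - q ^ (k + 1)) ≠ 0 := by
  simpa using tprod_one_sub_pow_mul_ne_zero hq (v := 1) (by simpa using one_sub_pow_ne_zero hq)

/-- The Jacobi triple product. -/
theorem tsum_tripleTerm (τ : ℍ) (z : ℂ) {q : ℂ} (hq : q = cexp (2 * Real.pi * I * τ)) :
    ∑' i, tripleTerm τ z i = (∏' k : ℕ, (1 - q ^ (k + 1))) * ((∏' k : ℕ, (1 - q ^ k * cexp (-z))) *
      ∏' k : ℕ, (1 - q ^ (k + 1) * cexp z)) := by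
  have hq1 : ‖q‖ < 1 := hq ▸ norm_nome_lt_one τ
  have hlim := tendsto_eulerProd hq1
  have hne := tprod_one_sub_pow_ne_zero hq1
  set a := ∏' k : ℕ, (1 - q ^ (k + 1)) with ha
  have hlim' := hlim.inv₀ hne
  obtain ⟨B, hB⟩ := hlim.norm.bddAbove_range
  obtain ⟨B', hB'⟩ := hlim'.norm.bddAbove_range
  have hB m : ‖eulerProd q m‖ ≤ B := hB ⟨m, rfl⟩
  have hB' m : ‖(eulerProd q m)⁻¹‖ ≤ B' := hB' ⟨m, rfl⟩
  have hB0 : 0 ≤ B := (norm_nonneg _).trans (hB 0)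
  have hB0' : 0 ≤ B' := (norm_nonneg _).trans (hB' 0)
  -- The finite triple product, extended by zero to all of `ℤ`. Its coefficients are uniformly
  -- bounded and tend to `a * (a⁻¹ * a⁻¹) = a⁻¹`, so dominated convergence applies.
  set F : ℕ → ℤ → ℂ := fun N i => if i ∈ Finset.Icc (-(N : ℤ)) N then eulerProd q (2 * N) *
    ((eulerProd q (N + i).toNat)⁻¹ * (eulerProd q (N - i).toNat)⁻¹) * tripleTerm τ z i else 0
    with hF
  have hsum (N : ℕ) : ∑' i, F N i = (∏ k ∈ Finset.range N, (1 - q ^ k * cexp (-z))) *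
        (∏ k ∈ Finset.range N, (1 - q ^ (k + 1) * cexp z)) := by
    rw [prod_mul_prod_eq_sum_tripleTerm τ z N hq hq1,
      tsum_eq_sum (s := Finset.Icc (-(N : ℤ)) N) (fun i hi => if_neg hi)]
    refine Finset.sum_nbij' (fun i => (N + i).toNat) (fun j => (j : ℤ) - N) ?_ ?_ ?_ ?_ ?_
    · intro i hi
      simp only [Finset.mem_Icc, Finset.mem_range] at hi ⊢
      omega
    · intro j hj
      simp only [Finset.mem_Icc, Finset.mem_range] at hj ⊢
      omega
    · intro i hi
      simp only [Finset.mem_Icc] at hi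
      omega
    · intro j hj
      simp only [Finset.mem_range] at hj
      omega
    · intro i hi
      have hi' := Finset.mem_Icc.1 hi
      simp only [if_pos hi]
      rw [show (((N : ℤ) + i).toNat : ℤ) - N = i by omega,
        show 2 * N - ((N : ℤ) + i).toNat = ((N : ℤ) - i).toNat by omega, div_eq_mul_inv, mul_inv]
  have hT : Tendsto (fun N => ∑' i, F N i) atTop (𝓝 (∑' i, a * (a⁻¹ * a⁻¹) * tripleTerm τ z i)) := by
    refine tendsto_tsum_of_dominated_convergence (bound := fun i => B * (B' * B') * ‖tripleTerm τ z i‖)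
      ((summable_norm_tripleTerm_and_thetaOdd_eq τ z).1.mul_left _) (fun i => ?_)
      (Eventually.of_forall fun N i => ?_)
    · have h2 : Tendsto (fun N : ℕ => 2 * N) atTop atTop :=
        tendsto_atTop_mono (fun N => by simp only [id]; omega) tendsto_id
      have h3 : Tendsto (fun N : ℕ => ((N : ℤ) + i).toNat) atTop atTop :=
        tendsto_atTop.2 fun b => (eventually_ge_atTop (b + i.natAbs)).mono fun N hN => by omega
      have h4 : Tendsto (fun N : ℕ => ((N : ℤ) - i).toNat) atTop atTop :=
        tendsto_atTop.2 fun b => (eventually_ge_atTop (b + i.natAbs)).mono fun N hN => by omega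
      refine (((hlim.comp h2).mul ((hlim'.comp h3).mul (hlim'.comp h4))).mul_const
        (tripleTerm τ z i)).congr' ?_
      filter_upwards [eventually_ge_atTop i.natAbs] with N hN
      simp only [hF]
      rw [if_pos (Finset.mem_Icc.2 (by omega))]
      rfl
    · simp only [hF]
      split_ifs
      · rw [norm_mul, norm_mul, norm_mul]
        gcongr
        · exact hB _
        · exact hB' _
        · exact hB' _
      · rw [norm_zero]
        positivity
  have hP := (multipliable_one_sub_pow_mul hq1 (cexp (-z))).hasProd.tendsto_prod_nat.mul
    (((multipliable_one_sub_pow_mul hq1 (q * cexp z)).congr (g := fun k => 1 - q ^ (k + 1) * cexp z)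
      fun k => by ring).hasProd.tendsto_prod_nat)
  have := tendsto_nhds_unique hP (hT.congr hsum)
  rw [this, tsum_mul_left]
  field_simp

/-- The product of the factors of `ϑ₁` which do not vanish at the origin. -/
def thetaOddCofactor (τ : ℍ) (z : ℂ) : ℂ :=
  cexp (I * Real.pi * τ / 4 + (z + Real.pi * I) / 2) *
    (∏' k : ℕ, (1 - cexp (2 * Real.pi * I * τ) ^ (k + 1))) *
    ((∏' k : ℕ, (1 - cexp (2 * Real.pi * I * τ) ^ (k + 1) * cexp (-z))) *
      ∏' k : ℕ, (1 - cexp (2 * Real.pi * I * τ) ^ (k + 1) * cexp z))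

/-- The product expansion of `ϑ₁`. -/
theorem thetaOdd_eq_prod (τ : ℍ) (z : ℂ) :
    thetaOdd z τ = (1 - cexp (-z)) * thetaOddCofactor τ z := by
  rw [(summable_norm_tripleTerm_and_thetaOdd_eq τ z).2, tsum_tripleTerm τ z rfl,
    tprod_eq_zero_mul' (f := fun k : ℕ => 1 - cexp (2 * Real.pi * I * τ) ^ k * cexp (-z))
      ((multipliable_one_sub_pow_mul (norm_nome_lt_one τ)
        (cexp (2 * Real.pi * I * τ) * cexp (-z))).congr fun k => by ring), thetaOddCofactor,
    pow_zero]
  ring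

lemma mem_periodLattice_of_exp_eq {τ : ℍ} {z : ℂ} {m : ℤ}
    (h : cexp z = cexp (m * (2 * Real.pi * I * τ))) : z ∈ periodLattice τ := by
  obtain ⟨k, hk⟩ := Complex.exp_eq_exp_iff_exists_int.1 h
  exact ⟨k, m, by rw [hk]; ring⟩

/-- Off the lattice no factor of the convergent product vanishes. On the lattice the zero at the
origin is carried along by quasi-periodicity. -/
theorem thetaOdd_eq_zero_iff (τ : ℍ) (z : ℂ) : thetaOdd z τ = 0 ↔ z ∈ periodLattice τ := by
  have hq1 := norm_nome_lt_one τ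
  have hqk (k : ℕ) : cexp (2 * Real.pi * I * τ) ^ k = cexp ((k : ℤ) * (2 * Real.pi * I * τ)) := by
    rw [← Complex.exp_nat_mul]; norm_cast
  constructor
  · intro h
    by_contra hz
    have hneg : -z ∉ periodLattice τ := by
      rintro ⟨k, m, hkm⟩
      refine hz ⟨-k, -m, ?_⟩
      rw [← neg_neg z, hkm]
      push_cast
      ring
    have hfac (v : ℂ) (hv : v ∉ periodLattice τ) (k : ℕ) :
        1 - cexp (2 * Real.pi * I * τ) ^ k * cexp v ≠ 0 := by
      intro h0
      refine hv (mem_periodLattice_of_exp_eq (m := -k) ?_)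
      rw [hqk, sub_eq_zero] at h0
      rw [Int.cast_neg, neg_mul, Complex.exp_neg]
      exact eq_inv_of_mul_eq_one_right h0.symm
    rw [thetaOdd_eq_prod, thetaOddCofactor] at h
    refine absurd h (mul_ne_zero ?_ (mul_ne_zero (mul_ne_zero (Complex.exp_ne_zero _) ?_)
      (mul_ne_zero ?_ ?_)))
    · simpa using hfac _ hneg 0
    · exact tprod_one_sub_pow_ne_zero hq1
    · exact tprod_one_sub_pow_mul_ne_zero hq1 fun k => hfac _ hneg _
    · exact tprod_one_sub_pow_mul_ne_zero hq1 fun k => hfac _ hz _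
  · have h1 (k : ℤ) : ∀ z, thetaOdd z τ = 0 → thetaOdd (z + k * (2 * Real.pi * I)) τ = 0 := by
      induction k with
      | zero => simp
      | succ k ih =>
        intro z hz
        have := thetaOdd_add_two_pi_I (z + k * (2 * Real.pi * I)) τ
        rw [show z + ((k + 1 : ℤ) : ℂ) * (2 * Real.pi * I) =
          z + k * (2 * Real.pi * I) + 2 * Real.pi * I by push_cast; ring, this]
        simpa using ih z hz
      | pred k ih =>
        intro z hz
        have := thetaOdd_add_two_pi_I (z + ((-k - 1 : ℤ) : ℂ) * (2 * Real.pi * I)) τ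
        rw [show z + ((-k - 1 : ℤ) : ℂ) * (2 * Real.pi * I) + 2 * Real.pi * I =
          z + ((-k : ℤ) : ℂ) * (2 * Real.pi * I) by push_cast; ring, ih z hz] at this
        exact neg_eq_zero.1 this.symm
    have h2 (k : ℤ) : ∀ z, thetaOdd z τ = 0 → thetaOdd (z + k * (2 * Real.pi * I * τ)) τ = 0 := by
      induction k with
      | zero => simp
      | succ k ih =>
        intro z hz
        have := thetaOdd_add_tau (z + k * (2 * Real.pi * I * τ)) τ
        rw [show z + ((k + 1 : ℤ) : ℂ) * (2 * Real.pi * I * τ) =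
          z + k * (2 * Real.pi * I * τ) + 2 * Real.pi * I * τ by push_cast; ring, this]
        simpa using ih z hz
      | pred k ih =>
        intro z hz
        have := thetaOdd_add_tau (z + ((-k - 1 : ℤ) : ℂ) * (2 * Real.pi * I * τ)) τ
        rw [show z + ((-k - 1 : ℤ) : ℂ) * (2 * Real.pi * I * τ) + 2 * Real.pi * I * τ =
          z + ((-k : ℤ) : ℂ) * (2 * Real.pi * I * τ) by push_cast; ring, ih z hz] at this
        exact (mul_eq_zero.1 this.symm).resolve_left (neg_ne_zero.2 (Complex.exp_ne_zero _))
    rintro ⟨k, m, rfl⟩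
    have := h2 m _ (h1 k 0 (thetaOdd_zero τ))
    convert this using 2
    ring

lemma continuousAt_tprod_one_sub_pow_mul_exp {q : ℂ} (hq : ‖q‖ < 1) {g : ℂ → ℂ}
    (hg : Continuous g) (z₀ : ℂ) :
    ContinuousAt (fun z => ∏' k : ℕ, (1 - q ^ (k + 1) * g z)) z₀ := by
  simp only [sub_eq_add_neg]
  refine tendsto_tprod_one_add_of_dominated_convergence
    (bound := fun k => ‖q‖ ^ (k + 1) * (‖g z₀‖ + 1)) ?_ (fun k => ?_) ?_
  · exact ((summable_nat_add_iff 1).2 (summable_geometric_of_lt_one (norm_nonneg _) hq)).mul_right _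
  · exact Continuous.tendsto (by fun_prop) _
  · have : ∀ᶠ z in 𝓝 z₀, ‖g z‖ < ‖g z₀‖ + 1 :=
      hg.norm.continuousAt.eventually_lt continuousAt_const (by simp)
    filter_upwards [this] with z hz k
    rw [norm_neg, norm_mul, norm_pow]
    gcongr

/-- Jacobi's derivative formula. -/
theorem hasDerivAt_thetaOdd_zero (τ : ℍ) :
    HasDerivAt (fun z => thetaOdd z τ) (I * ModularForm.eta τ ^ 3) 0 := by
  -- As `1 - exp (-z)` has a zero with derivative `1`, continuity of the cofactor is enough: the
  -- derivative of the product at `0` is the value of the cofactor.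
  have hV : ContinuousAt (thetaOddCofactor τ) 0 := by
    unfold thetaOddCofactor
    refine ContinuousAt.mul (Continuous.continuousAt (by fun_prop)) (ContinuousAt.mul ?_ ?_)
    · exact continuousAt_tprod_one_sub_pow_mul_exp (norm_nome_lt_one τ) (by fun_prop) 0
    · exact continuousAt_tprod_one_sub_pow_mul_exp (norm_nome_lt_one τ) (by fun_prop) 0
  have hV0 : thetaOddCofactor τ 0 = I * ModularForm.eta τ ^ 3 := by
    have hη : ModularForm.eta τ = cexp (2 * Real.pi * I * τ / 24) *
        ∏' k : ℕ, (1 - cexp (2 * Real.pi * I * τ) ^ (k + 1)) := by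
      rw [ModularForm.eta]
      simp only [ModularForm.eta_q_eq_pow]
      simp [Function.Periodic.qParam]
    rw [hη, mul_pow, ← Complex.exp_nat_mul, thetaOddCofactor, Complex.exp_add, zero_add,
      mul_comm (Real.pi : ℂ) I, mul_div_assoc I _ (2 : ℂ), mul_comm I (_ / _), Complex.exp_pi_div_two_mul_I]
    simp only [neg_zero, Complex.exp_zero, mul_one]
    rw [show ((3 : ℕ) : ℂ) * (2 * Real.pi * I * τ / 24) = I * Real.pi * τ / 4 by push_cast; ring]
    ring
  have hd : HasDerivAt (fun z : ℂ => 1 - cexp (-z)) 1 0 := by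
    have := ((hasDerivAt_neg (0 : ℂ)).cexp).const_sub 1
    simpa using this
  rw [hasDerivAt_iff_tendsto_slope] at hd ⊢
  have := hd.mul (hV.tendsto.mono_left (nhdsWithin_le_nhds (s := {0}ᶜ)))
  rw [one_mul, hV0] at this
  refine this.congr fun z => ?_
  rw [slope_def_field, slope_def_field, thetaOdd_zero, thetaOdd_eq_prod]
  simp
  ring

/-! ### Doubly periodic functions on a parallelogram -/

/-- The coordinate of `z` along the period `2πi τ`. -/
def tauCoord (τ : ℍ) (z : ℂ) : ℝ := (z / (2 * Real.pi * I)).im / τ.im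

/-- The coordinate of `z` along the period `2πi`. -/
def oneCoord (τ : ℍ) (z : ℂ) : ℝ := (z / (2 * Real.pi * I)).re - tauCoord τ z * τ.re

lemma eq_coords (τ : ℍ) (z : ℂ) :
    z = 2 * Real.pi * I * (oneCoord τ z + tauCoord τ z * τ) := by
  have h : z / (2 * Real.pi * I) = oneCoord τ z + tauCoord τ z * τ := by
    have := τ.im_ne_zero
    apply Complex.ext
    · simp [oneCoord]
    · simp [tauCoord, this]
  rw [← h]
  field_simp [Complex.two_pi_I_ne_zero]

lemma tauCoord_mk (τ : ℍ) (s t : ℝ) : tauCoord τ (2 * Real.pi * I * (s + t * τ)) = t := by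
  have := τ.im_ne_zero
  rw [tauCoord, mul_div_cancel_left₀ _ Complex.two_pi_I_ne_zero]
  simp [this]

lemma oneCoord_mk (τ : ℍ) (s t : ℝ) : oneCoord τ (2 * Real.pi * I * (s + t * τ)) = s := by
  rw [oneCoord, tauCoord_mk, mul_div_cancel_left₀ _ Complex.two_pi_I_ne_zero]
  simp

lemma tauCoord_add (τ : ℍ) (z : ℂ) (s t : ℝ) :
    tauCoord τ (z + 2 * Real.pi * I * (s + t * τ)) = tauCoord τ z + t := by
  conv_lhs => rw [eq_coords τ z, ← mul_add]
  rw [← tauCoord_mk τ (oneCoord τ z + s) (tauCoord τ z + t)]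
  congr 2
  push_cast
  ring

lemma oneCoord_add (τ : ℍ) (z : ℂ) (s t : ℝ) :
    oneCoord τ (z + 2 * Real.pi * I * (s + t * τ)) = oneCoord τ z + s := by
  conv_lhs => rw [eq_coords τ z, ← mul_add]
  rw [← oneCoord_mk τ (oneCoord τ z + s) (tauCoord τ z + t)]
  congr 2
  push_cast
  ring

lemma coords_add_two_pi_I (τ : ℍ) (z : ℂ) : oneCoord τ (z + 2 * Real.pi * I) = oneCoord τ z + 1 ∧
    tauCoord τ (z + 2 * Real.pi * I) = tauCoord τ z := by
  have h1 := oneCoord_add τ z 1 0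
  have h2 := tauCoord_add τ z 1 0
  simp only [ofReal_one, ofReal_zero, zero_mul, add_zero, mul_one] at h1 h2
  exact ⟨h1, h2⟩

lemma coords_add_tau (τ : ℍ) (z : ℂ) : oneCoord τ (z + 2 * Real.pi * I * τ) = oneCoord τ z ∧
    tauCoord τ (z + 2 * Real.pi * I * τ) = tauCoord τ z + 1 := by
  have h1 := oneCoord_add τ z 0 1
  have h2 := tauCoord_add τ z 0 1
  simp only [ofReal_one, ofReal_zero, zero_add, add_zero, one_mul] at h1 h2
  exact ⟨h1, h2⟩

lemma re_eq_tauCoord (τ : ℍ) (z : ℂ) : z.re = -(2 * Real.pi * τ.im) * tauCoord τ z := by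
  conv_lhs => rw [eq_coords τ z]
  simp
  ring

/-- The open parallelogram with vertices `2πi (±1 ± τ)`. -/
def periodBox (τ : ℍ) : Set ℂ := {z | |oneCoord τ z| < 1 ∧ |tauCoord τ z| < 1}

lemma mem_periodBox {τ : ℍ} {z : ℂ} :
    z ∈ periodBox τ ↔ |oneCoord τ z| < 1 ∧ |tauCoord τ z| < 1 := Iff.rfl

lemma continuous_tauCoord (τ : ℍ) : Continuous (tauCoord τ) := by
  unfold tauCoord
  exact (Complex.continuous_im.comp (by fun_prop)).div_const _

lemma continuous_oneCoord (τ : ℍ) : Continuous (oneCoord τ) := by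
  unfold oneCoord
  exact (Complex.continuous_re.comp (by fun_prop)).sub ((continuous_tauCoord τ).mul_const _)

lemma isOpen_periodBox (τ : ℍ) : IsOpen (periodBox τ) :=
  (isOpen_lt (continuous_oneCoord τ).abs continuous_const).inter
    (isOpen_lt (continuous_tauCoord τ).abs continuous_const)

lemma isPreconnected_periodBox (τ : ℍ) : IsPreconnected (periodBox τ) := by
  have : periodBox τ = (fun p : ℝ × ℝ => 2 * Real.pi * I * ((p.1 : ℂ) + p.2 * τ)) ''
      (Set.Ioo (-1) 1 ×ˢ Set.Ioo (-1) 1) := by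
    ext z
    constructor
    · rintro ⟨h1, h2⟩
      exact ⟨(oneCoord τ z, tauCoord τ z), ⟨abs_lt.1 h1, abs_lt.1 h2⟩, (eq_coords τ z).symm⟩
    · rintro ⟨p, ⟨h1, h2⟩, rfl⟩
      exact ⟨by rw [oneCoord_mk]; exact abs_lt.2 h1, by rw [tauCoord_mk]; exact abs_lt.2 h2⟩
  rw [this]
  exact (isPreconnected_Ioo.prod isPreconnected_Ioo).image _ (by fun_prop)

lemma zero_mem_periodBox (τ : ℍ) : (0 : ℂ) ∈ periodBox τ := by
  simp [mem_periodBox, oneCoord, tauCoord]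

lemma eq_zero_of_mem_periodBox {τ : ℍ} {z : ℂ} (hz : z ∈ periodBox τ) (hz' : z ∈ periodLattice τ) :
    z = 0 := by
  obtain ⟨k, m, rfl⟩ := hz'
  have h1 := oneCoord_mk τ k m
  have h2 := tauCoord_mk τ k m
  simp only [ofReal_intCast] at h1 h2
  rw [mem_periodBox, h1, h2] at hz
  have hk : k = 0 := Int.abs_lt_one_iff.1 (by exact_mod_cast hz.1)
  have hm : m = 0 := Int.abs_lt_one_iff.1 (by exact_mod_cast hz.2)
  simp [hk, hm]

/-- A holomorphic function on the parallelogram `periodBox τ` whose norm is invariant under the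
two periods is constant. -/
theorem exists_eq_const_of_norm_periodic {τ : ℍ} {D : ℂ → ℂ} (hD : DifferentiableOn ℂ D (periodBox τ))
    (h1 : ∀ z ∈ periodBox τ, z + 2 * Real.pi * I ∈ periodBox τ → ‖D (z + 2 * Real.pi * I)‖ = ‖D z‖)
    (h2 : ∀ z ∈ periodBox τ, z + 2 * Real.pi * I * τ ∈ periodBox τ →
      ‖D (z + 2 * Real.pi * I * τ)‖ = ‖D z‖) :
    ∃ c, ∀ z ∈ periodBox τ, D z = c := by
  -- `K` is a closed fundamental parallelogram inside the open box. Each point of the box has a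
  -- translate in `K` reached within the box, so the maximum of the norm on `K` is an interior
  -- maximum on the box.
  set K : Set ℂ := {z | |oneCoord τ z| ≤ 1 / 2 ∧ |tauCoord τ z| ≤ 1 / 2} with hK
  have hKW : K ⊆ periodBox τ := fun z hz => ⟨hz.1.trans_lt (by norm_num), hz.2.trans_lt (by norm_num)⟩
  have hKc : IsCompact K := by
    have : K = (fun p : ℝ × ℝ => 2 * Real.pi * I * ((p.1 : ℂ) + p.2 * τ)) ''
        (Set.Icc (-(1 / 2)) (1 / 2) ×ˢ Set.Icc (-(1 / 2)) (1 / 2)) := by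
      ext z
      constructor
      · rintro ⟨h1, h2⟩
        exact ⟨(oneCoord τ z, tauCoord τ z), ⟨abs_le.1 h1, abs_le.1 h2⟩, (eq_coords τ z).symm⟩
      · rintro ⟨p, ⟨h1, h2⟩, rfl⟩
        exact ⟨by rw [oneCoord_mk]; exact abs_le.2 h1, by rw [tauCoord_mk]; exact abs_le.2 h2⟩
    rw [this]
    exact (isCompact_Icc.prod isCompact_Icc).image (by fun_prop)
  have hK0 : (0 : ℂ) ∈ K := by simp [hK, oneCoord, tauCoord]
  obtain ⟨p, hp, hmax⟩ := hKc.exists_isMaxOn ⟨0, hK0⟩ (hD.continuousOn.mono hKW).norm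
  have step1 (z : ℂ) (hz : z ∈ periodBox τ) : ∃ z' ∈ periodBox τ, |oneCoord τ z'| ≤ 1 / 2 ∧
      ‖D z'‖ = ‖D z‖ := by
    obtain ⟨ha, hb⟩ := mem_periodBox.1 hz
    obtain ⟨ha1, ha2⟩ := abs_lt.1 ha
    by_cases hs : |oneCoord τ z| ≤ 1 / 2
    · exact ⟨z, hz, hs, rfl⟩
    rcases lt_abs.1 (not_le.1 hs) with h | h
    · have hc := coords_add_two_pi_I τ (z - 2 * Real.pi * I)
      rw [sub_add_cancel] at hc
      have hmem : z - 2 * Real.pi * I ∈ periodBox τ :=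
        ⟨abs_lt.2 ⟨by linarith [hc.1], by linarith [hc.1]⟩, by rwa [← hc.2]⟩
      refine ⟨_, hmem, abs_le.2 ⟨by linarith [hc.1], by linarith [hc.1]⟩, ?_⟩
      have := h1 _ hmem (by rwa [sub_add_cancel])
      rw [sub_add_cancel] at this
      exact this.symm
    · have hc := coords_add_two_pi_I τ z
      have hmem : z + 2 * Real.pi * I ∈ periodBox τ :=
        ⟨abs_lt.2 ⟨by linarith [hc.1], by linarith [hc.1]⟩, by rwa [hc.2]⟩
      exact ⟨_, hmem, abs_le.2 ⟨by linarith [hc.1], by linarith [hc.1]⟩, h1 z hz hmem⟩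
  have step2 (z : ℂ) (hz : z ∈ periodBox τ) (hzs : |oneCoord τ z| ≤ 1 / 2) :
      ∃ z' ∈ K, ‖D z'‖ = ‖D z‖ := by
    obtain ⟨ha, hb⟩ := mem_periodBox.1 hz
    obtain ⟨hb1, hb2⟩ := abs_lt.1 hb
    by_cases hs : |tauCoord τ z| ≤ 1 / 2
    · exact ⟨z, ⟨hzs, hs⟩, rfl⟩
    rcases lt_abs.1 (not_le.1 hs) with h | h
    · have hc := coords_add_tau τ (z - 2 * Real.pi * I * τ)
      rw [sub_add_cancel] at hc
      have hmem : z - 2 * Real.pi * I * τ ∈ K :=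
        ⟨by rwa [← hc.1], abs_le.2 ⟨by linarith [hc.2], by linarith [hc.2]⟩⟩
      refine ⟨_, hmem, ?_⟩
      have := h2 _ (hKW hmem) (by rwa [sub_add_cancel])
      rw [sub_add_cancel] at this
      exact this.symm
    · have hc := coords_add_tau τ z
      have hmem : z + 2 * Real.pi * I * τ ∈ K :=
        ⟨by rwa [hc.1], abs_le.2 ⟨by linarith [hc.2], by linarith [hc.2]⟩⟩
      exact ⟨_, hmem, h2 z hz (hKW hmem)⟩
  have hmax' : IsMaxOn (norm ∘ D) (periodBox τ) p := by
    intro z hz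
    obtain ⟨z1, hz1, hs, e1⟩ := step1 z hz
    obtain ⟨z2, hz2, e2⟩ := step2 z1 hz1 hs
    simp only [Set.mem_ofPred_eq, Function.comp_apply]
    rw [← e1, ← e2]
    exact hmax hz2
  exact ⟨D p, Complex.eqOn_of_isPreconnected_of_isMaxOn_norm (isPreconnected_periodBox τ)
    (isOpen_periodBox τ) hD (hKW hp) hmax'⟩

/-! ### Generalized Laurent series on a strip -/

lemma norm_cexp_add_ofReal_mul (k : ℤ) (l : ℝ) (z : ℂ) :
    ‖cexp (((k : ℂ) + l) * z)‖ = Real.exp ((k + l) * z.re) := by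
  rw [Complex.norm_exp]
  congr 1
  simp

lemma summable_exp_neg_mul_abs {c : ℝ} (hc : 0 < c) :
    Summable fun k : ℤ => Real.exp (-(c * |(k : ℝ)|)) := by
  have h : Summable fun n : ℕ => Real.exp (-(c * |((n : ℤ) : ℝ)|)) := by
    refine (Real.summable_exp_nat_mul_iff.2 (neg_lt_zero.2 hc)).congr fun n => ?_
    simp only [Int.cast_natCast, Nat.abs_cast]
    congr 1
    ring
  refine Summable.of_nat_of_neg h (h.congr fun n => ?_)
  simp

lemma summable_norm_mul_cexp {b : ℤ → ℂ} {C T : ℝ} (l : ℝ)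
    (hb : ∀ k, ‖b k‖ ≤ C * Real.exp (-(T * |(k : ℝ)|))) {z : ℂ} (hz : |z.re| < T) :
    Summable fun k => ‖b k * cexp (((k : ℂ) + l) * z)‖ := by
  refine Summable.of_nonneg_of_le (fun _ => norm_nonneg _) (fun k => ?_)
    ((summable_exp_neg_mul_abs (sub_pos.2 hz)).mul_left (C * Real.exp (l * z.re)))
  rw [norm_mul, norm_cexp_add_ofReal_mul]
  have h1 : (k : ℝ) * z.re ≤ |(k : ℝ)| * |z.re| := by
    rw [← abs_mul]; exact le_abs_self _
  have h0 : 0 ≤ C := by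
    have := (norm_nonneg _).trans (hb 0)
    simpa using this
  calc ‖b k‖ * Real.exp ((k + l) * z.re)
      ≤ C * Real.exp (-(T * |(k : ℝ)|)) * Real.exp (|(k : ℝ)| * |z.re| + l * z.re) := by
        gcongr
        · exact hb k
        · linarith
    _ = _ := by
        rw [mul_assoc, ← Real.exp_add, mul_assoc, ← Real.exp_add]
        congr 2
        ring

lemma differentiableOn_tsum_mul_cexp {b : ℤ → ℂ} {C T : ℝ} (l : ℝ)
    (hb : ∀ k, ‖b k‖ ≤ C * Real.exp (-(T * |(k : ℝ)|))) :
    DifferentiableOn ℂ (fun z => ∑' k : ℤ, b k * cexp (((k : ℂ) + l) * z)) {z | |z.re| < T} := by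
  intro z hz
  obtain ⟨r, hr1, hr2⟩ := exists_between (show |z.re| < T from hz)
  have hr0 : 0 ≤ r := (abs_nonneg _).trans hr1.le
  have hopen : IsOpen {z : ℂ | |z.re| < r} :=
    isOpen_lt Complex.continuous_re.abs continuous_const
  -- On `|Re z| < r` each term is dominated by the sum of its norms at `r` and `-r`, whatever the
  -- sign of `k + l`.
  have hs (ρ : ℝ) (hρ : |ρ| = r) := summable_norm_mul_cexp l hb (z := (ρ : ℂ)) (by simpa [hρ])
  have h := differentiableOn_tsum_of_summable_norm
    ((hs r (abs_of_nonneg hr0)).add (hs (-r) (by rw [abs_neg, abs_of_nonneg hr0])))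
    (F := fun k z => b k * cexp (((k : ℂ) + l) * z)) (fun k => by fun_prop) hopen ?_
  · exact (h.differentiableAt (hopen.mem_nhds hr1)).differentiableWithinAt
  · intro k w hw
    obtain ⟨hw1, hw2⟩ := abs_lt.1 (show |w.re| < r from hw)
    simp only [norm_mul, norm_cexp_add_ofReal_mul, ofReal_re]
    rw [← mul_add]
    refine mul_le_mul_of_nonneg_left ?_ (norm_nonneg _)
    rcases le_total 0 ((k : ℝ) + l) with h | h
    · have : Real.exp ((k + l) * w.re) ≤ Real.exp ((k + l) * r) := by gcongr
      linarith [Real.exp_pos ((k + l) * -r)]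
    · have : Real.exp ((k + l) * w.re) ≤ Real.exp ((k + l) * -r) :=
        Real.exp_le_exp.2 (mul_le_mul_of_nonpos_left hw1.le h)
      linarith [Real.exp_pos ((k + l) * r)]

/-- With `hasSum_neg_cexp` this gives the expansions of one meromorphic function on both sides of
the imaginary axis, which carry the defining series across it. -/
lemma hasSum_nonneg_cexp (l : ℝ) {z : ℂ} (hz : z.re < 0) :
    HasSum (fun k : ℤ => if 0 ≤ k then cexp (((k : ℂ) + l) * z) else 0)
      (cexp (l * z) / (1 - cexp z)) := by
  have hn : ‖cexp z‖ < 1 := by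
    rw [Complex.norm_exp, Real.exp_lt_one_iff]
    exact hz
  have h : HasSum (fun n : ℕ => cexp (l * z) * cexp z ^ n) (cexp (l * z) * (1 - cexp z)⁻¹) :=
    HasSum.mul_left _ (hasSum_geometric_of_norm_lt_one hn)
  rw [div_eq_mul_inv, ← Function.Injective.hasSum_iff (g := ((↑) : ℕ → ℤ)) Nat.cast_injective]
  · convert! h using 1
    funext n
    simp only [Function.comp_apply, Int.natCast_nonneg, if_true]
    rw [← Complex.exp_nat_mul, ← Complex.exp_add]
    congr 1
    push_cast
    ring
  · intro k hk
    exact if_neg fun h => hk ⟨k.toNat, Int.toNat_of_nonneg h⟩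

lemma hasSum_neg_cexp (l : ℝ) {z : ℂ} (hz : 0 < z.re) :
    HasSum (fun k : ℤ => if 0 ≤ k then 0 else cexp (((k : ℂ) + l) * z))
      (-(cexp (l * z) / (1 - cexp z))) := by
  have hne : 1 - cexp z ≠ 0 := by
    intro h
    have : ‖cexp z‖ = 1 := by rw [← sub_eq_zero.1 h, norm_one]
    rw [Complex.norm_exp, Real.exp_eq_one_iff] at this
    exact hz.ne' this
  have hn : ‖cexp (-z)‖ < 1 := by
    rw [Complex.norm_exp, Real.exp_lt_one_iff, Complex.neg_re]
    exact neg_lt_zero.2 hz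
  have h : HasSum (fun n : ℕ => cexp (l * z - z) * cexp (-z) ^ n)
      (cexp (l * z - z) * (1 - cexp (-z))⁻¹) :=
    HasSum.mul_left _ (hasSum_geometric_of_norm_lt_one hn)
  have hval : cexp (l * z - z) * (1 - cexp (-z))⁻¹ = -(cexp (l * z) / (1 - cexp z)) := by
    have h3 : cexp z - 1 ≠ 0 := fun h => hne (by linear_combination -h)
    have h2 : 1 - (cexp z)⁻¹ = (cexp z - 1) / cexp z := by
      field_simp [Complex.exp_ne_zero z]
    rw [Complex.exp_sub, Complex.exp_neg, h2]
    have := Complex.exp_ne_zero z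
    field_simp
    ring
  rw [hval] at h
  rw [← Function.Injective.hasSum_iff (g := Int.negSucc) (fun a b h => Int.negSucc.inj h)]
  · convert! h using 1
    funext n
    simp only [Function.comp_apply, if_neg (not_le.2 (Int.negSucc_lt_zero n))]
    rw [← Complex.exp_nat_mul, ← Complex.exp_add]
    congr 1
    rw [Int.cast_negSucc]
    push_cast
    ring
  · intro k hk
    refine if_pos ?_
    by_contra h
    obtain ⟨n, rfl⟩ := Int.eq_negSucc_of_lt_zero (not_le.1 h)
    exact hk ⟨n, rfl⟩

/-! ### Analytic continuation of the defining series -/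

lemma norm_cexp_tau_mul (τ : ℍ) (x : ℝ) :
    ‖cexp (2 * Real.pi * I * τ * x)‖ = Real.exp (-(2 * Real.pi * τ.im * x)) := by
  rw [Complex.norm_exp]
  congr 1
  simp

lemma two_pi_mul_im_pos (τ : ℍ) : 0 < 2 * Real.pi * τ.im :=
  mul_pos Real.two_pi_pos τ.im_pos

/-- The coefficients `a k = 1 / (1 - θ⁻¹ q ^ (k + l))`, with the possible exception of `k = 0`. -/
def IsLambertCoeff (τ : ℍ) (θ : ℂ) (l : ℝ) (ε : ℂ) (a : ℤ → ℂ) : Prop :=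
  ∀ k : ℤ, a k * (1 - θ⁻¹ * cexp (2 * Real.pi * I * τ * (k + l : ℝ))) =
    1 - if k = 0 then ε else 0

/-- The analytic continuation of the series `-∑ a k exp ((k + l) z)` across the line `Re z = 0`. -/
def stripSeries (l : ℝ) (a : ℤ → ℂ) (z : ℂ) : ℂ :=
  -(cexp (l * z) / (1 - cexp z)) -
    ∑' k : ℤ, (a k - if 0 ≤ k then 1 else 0) * cexp (((k : ℂ) + l) * z)

section

variable {τ : ℍ} {θ ε : ℂ} {l : ℝ} {a : ℤ → ℂ}

lemma IsLambertCoeff.exists_norm_le (ha : IsLambertCoeff τ θ l ε a) (hθ : ‖θ‖ = 1) :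
    ∃ A, ∀ k, ‖a k‖ ≤ A := by
  have hT := two_pi_mul_im_pos τ
  set T := 2 * Real.pi * τ.im with hTdef
  -- Beyond `M` one has `T |k + l| ≥ 1`, so `θ⁻¹ q^(k+l)` has norm at least `e ≥ 2` or at most `1/e
  -- ≤ 1/2`, and the denominator has norm at least `1/2`.
  set M : ℤ := ⌈1 / T + |l|⌉ with hM
  refine ⟨2 * (1 + ‖ε‖) + ∑ k ∈ Finset.Icc (-M) M, ‖a k‖, fun k => ?_⟩
  by_cases hk : k ∈ Finset.Icc (-M) M
  · have := Finset.single_le_sum (f := fun k => ‖a k‖) (fun i _ => norm_nonneg _) hk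
    have h0 := norm_nonneg ε
    linarith
  have hsum : 0 ≤ ∑ k ∈ Finset.Icc (-M) M, ‖a k‖ := Finset.sum_nonneg fun _ _ => norm_nonneg _
  refine le_trans ?_ (le_add_of_nonneg_right hsum)
  have hQ := norm_cexp_tau_mul τ (k + l)
  rw [← hTdef] at hQ
  have hden : 1 / 2 ≤ ‖1 - θ⁻¹ * cexp (2 * Real.pi * I * τ * (k + l : ℝ))‖ := by
    have hn : ‖θ⁻¹ * cexp (2 * Real.pi * I * τ * (k + l : ℝ))‖ = Real.exp (-(T * (k + l))) := by
      rw [norm_mul, norm_inv, hθ, hQ, inv_one, one_mul]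
    have he : (2 : ℝ) ≤ Real.exp 1 := by linarith [Real.add_one_le_exp (1 : ℝ)]
    have hMle : 1 / T + |l| ≤ M := Int.le_ceil _
    have hT1 : T * (1 / T) = 1 := by field_simp
    rw [Finset.mem_Icc, not_and_or, not_le, not_le] at hk
    rcases hk with hk | hk
    · have hk' : (k : ℝ) < -M := by exact_mod_cast hk
      have h1 : k + l ≤ -(1 / T) := by linarith [le_abs_self l]
      have h2 : 1 ≤ -(T * (k + l)) := by nlinarith
      have h3 : 2 ≤ Real.exp (-(T * (k + l))) := he.trans (Real.exp_le_exp.2 h2)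
      have := norm_sub_norm_le (θ⁻¹ * cexp (2 * Real.pi * I * τ * (k + l : ℝ))) 1
      rw [norm_one, hn, norm_sub_rev] at this
      linarith
    · have hk' : (M : ℝ) < k := by exact_mod_cast hk
      have h1 : 1 / T ≤ k + l := by linarith [neg_abs_le l]
      have h2 : 1 ≤ T * (k + l) := by nlinarith
      have h3 : Real.exp (-(T * (k + l))) ≤ 1 / 2 := by
        rw [Real.exp_neg, one_div]
        exact inv_anti₀ (by norm_num) (he.trans (Real.exp_le_exp.2 h2))
      have := norm_sub_norm_le 1 (θ⁻¹ * cexp (2 * Real.pi * I * τ * (k + l : ℝ)))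
      rw [norm_one, hn] at this
      linarith
  have hle : ‖a k‖ * ‖1 - θ⁻¹ * cexp (2 * Real.pi * I * τ * (k + l : ℝ))‖ ≤ 1 + ‖ε‖ := by
    rw [← norm_mul, ha k]
    refine (norm_sub_le _ _).trans ?_
    rw [norm_one]
    split_ifs <;> simp
  nlinarith [norm_nonneg (a k)]

/-- Put `Q = θ⁻¹ q^(k+l)`. Apart from `ε` at `k = 0`, `a k - 1 = a k * Q`. For `k ≥ 0` the right
side decays with `Q`; for `k < 0` the left side is bounded while `Q` grows, so `a k` decays. The
rate makes the corrected series converge for `|Re z| < 2π Im τ`. -/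
lemma IsLambertCoeff.exists_norm_sub_le (ha : IsLambertCoeff τ θ l ε a) (hθ : ‖θ‖ = 1) :
    ∃ C, ∀ k : ℤ, ‖a k - if 0 ≤ k then 1 else 0‖ ≤
      C * Real.exp (-(2 * Real.pi * τ.im * |(k : ℝ)|)) := by
  obtain ⟨A, hA⟩ := ha.exists_norm_le hθ
  set T := 2 * Real.pi * τ.im with hTdef
  have hA0 : 0 ≤ A := (norm_nonneg _).trans (hA 0)
  refine ⟨(A + 1) * (Real.exp (T * l) + Real.exp (-(T * l))) + ‖ε‖, fun k => ?_⟩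
  have hn : ‖θ⁻¹ * cexp (2 * Real.pi * I * τ * (k + l : ℝ))‖ = Real.exp (-(T * (k + l))) := by
    rw [norm_mul, norm_inv, hθ, norm_cexp_tau_mul τ (k + l), inv_one, one_mul]
  have hak := ha k
  set Q := θ⁻¹ * cexp (2 * Real.pi * I * τ * (k + l : ℝ)) with hQ
  have hE := (Real.exp_pos (-(T * |(k : ℝ)|))).le
  have hE1 := (Real.exp_pos (T * l)).le
  have hE2 := (Real.exp_pos (-(T * l))).le
  rcases le_or_gt 0 k with hk | hk
  · rw [if_pos hk]
    have h1 : a k - 1 = a k * Q - if k = 0 then ε else 0 := by linear_combination hak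
    have hk' : |(k : ℝ)| = k := abs_of_nonneg (by exact_mod_cast hk)
    have h2 : ‖a k * Q‖ ≤ A * (Real.exp (-(T * l)) * Real.exp (-(T * |(k : ℝ)|))) := by
      rw [norm_mul, hn, hk', ← Real.exp_add]
      refine mul_le_mul (hA k) (le_of_eq ?_) (Real.exp_pos _).le hA0
      congr 1
      ring
    have h3 : ‖(if k = 0 then ε else 0 : ℂ)‖ ≤ ‖ε‖ * Real.exp (-(T * |(k : ℝ)|)) := by
      split_ifs with h0
      · simp [h0]
      · rw [norm_zero]
        positivity
    rw [h1]
    refine (norm_sub_le _ _).trans ((add_le_add h2 h3).trans ?_)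
    rw [← mul_assoc, ← add_mul]
    refine mul_le_mul_of_nonneg_right ?_ hE
    nlinarith [mul_nonneg hA0 hE1]
  · rw [if_neg (not_le.2 hk), sub_zero]
    have h1 : a k * Q = a k - 1 := by
      rw [if_neg hk.ne] at hak
      linear_combination -hak
    have hk' : |(k : ℝ)| = -k := abs_of_neg (by exact_mod_cast hk)
    have h2 : ‖a k‖ * Real.exp (-(T * (k + l))) ≤ A + 1 := by
      rw [← hn, ← norm_mul, h1]
      refine (norm_sub_le _ _).trans ?_
      rw [norm_one]
      linarith [hA k]
    have h3 : ‖a k‖ ≤ (A + 1) * (Real.exp (T * l) * Real.exp (-(T * |(k : ℝ)|))) := by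
      calc ‖a k‖ = ‖a k‖ * Real.exp (-(T * (k + l))) * Real.exp (T * (k + l)) := by
            rw [mul_assoc, ← Real.exp_add, neg_add_cancel, Real.exp_zero, mul_one]
        _ ≤ (A + 1) * Real.exp (T * (k + l)) := by gcongr
        _ = _ := by
          rw [hk', ← Real.exp_add]
          congr 2
          ring
    refine h3.trans ?_
    rw [← mul_assoc]
    refine mul_le_mul_of_nonneg_right ?_ hE
    nlinarith [mul_nonneg hA0 hE2, norm_nonneg ε]

lemma IsLambertCoeff.hasSum_of_re_neg (ha : IsLambertCoeff τ θ l ε a) (hθ : ‖θ‖ = 1) {z : ℂ}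
    (hz1 : -(2 * Real.pi * τ.im) < z.re) (hz2 : z.re < 0) :
    HasSum (fun k : ℤ => a k * cexp (((k : ℂ) + l) * z)) (-stripSeries l a z) := by
  obtain ⟨C, hC⟩ := ha.exists_norm_sub_le hθ
  have h1 := (summable_norm_mul_cexp l hC (z := z)
    (abs_lt.2 ⟨hz1, by linarith [two_pi_mul_im_pos τ]⟩)).of_norm.hasSum
  have h2 := h1.add (hasSum_nonneg_cexp l hz2)
  convert! h2 using 1
  · funext k
    split_ifs <;> ring
  · rw [stripSeries]
    ring

lemma IsLambertCoeff.hasSum_of_re_pos (ha : IsLambertCoeff τ θ l ε a) (hθ : ‖θ‖ = 1) {z : ℂ}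
    (hz1 : 0 < z.re) (hz2 : z.re < 2 * Real.pi * τ.im) :
    HasSum (fun k : ℤ => (a k - 1) * cexp (((k : ℂ) + l) * z)) (-stripSeries l a z) := by
  obtain ⟨C, hC⟩ := ha.exists_norm_sub_le hθ
  have h1 := (summable_norm_mul_cexp l hC (z := z)
    (abs_lt.2 ⟨by linarith [two_pi_mul_im_pos τ], hz2⟩)).of_norm.hasSum
  have h2 := h1.sub (hasSum_neg_cexp l hz1)
  convert! h2 using 1
  · funext k
    split_ifs <;> ring
  · rw [stripSeries]
    ring

/-- The translation crosses the imaginary axis, where the coefficients change from `a k - 1` to `a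
k`. The relation `a k - 1 = θ⁻¹ q^(k+l) a k`, with defect `ε` at `k = 0`, compares the two
expansions. -/
lemma IsLambertCoeff.stripSeries_add_tau (ha : IsLambertCoeff τ θ l ε a) (hθ : ‖θ‖ = 1) {z : ℂ}
    (hz1 : 0 < z.re) (hz2 : z.re < 2 * Real.pi * τ.im) :
    stripSeries l a (z + 2 * Real.pi * I * τ) = θ * (stripSeries l a z - ε * cexp (l * z)) := by
  have hθ0 : θ ≠ 0 := norm_ne_zero_iff.1 (by rw [hθ]; exact one_ne_zero)
  have hre : (z + 2 * Real.pi * I * τ).re = z.re - 2 * Real.pi * τ.im := by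
    simp
    ring
  have h1 := (ha.hasSum_of_re_neg hθ (z := z + 2 * Real.pi * I * τ) (by rw [hre]; linarith)
    (by rw [hre]; linarith)).mul_left θ⁻¹
  have h2 := ha.hasSum_of_re_pos hθ hz1 hz2
  have h3 := h1.sub (hasSum_ite_eq (0 : ℤ) (ε * cexp (l * z)))
  have h4 : (fun k : ℤ => (a k - 1) * cexp (((k : ℂ) + l) * z)) =
      fun k : ℤ => θ⁻¹ * (a k * cexp (((k : ℂ) + l) * (z + 2 * Real.pi * I * τ))) -
        if k = 0 then ε * cexp (l * z) else 0 := by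
    funext k
    have hak := ha k
    have he : cexp (((k : ℂ) + l) * (z + 2 * Real.pi * I * τ)) =
        cexp (2 * Real.pi * I * τ * (k + l : ℝ)) * cexp (((k : ℂ) + l) * z) := by
      rw [← Complex.exp_add]
      congr 1
      push_cast
      ring
    rw [he]
    split_ifs at hak ⊢ with h0
    · subst h0
      simp only [Int.cast_zero, zero_add] at hak ⊢
      linear_combination cexp (l * z) * hak
    · linear_combination cexp (((k : ℂ) + l) * z) * hak
  rw [h4] at h2
  have h5 := h3.unique h2
  have h6 : θ * θ⁻¹ = 1 := mul_inv_cancel₀ hθ0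
  linear_combination -θ * h5 - stripSeries l a (z + 2 * Real.pi * I * τ) * h6

end

lemma stripSeries_add_two_pi_I (l : ℝ) (a : ℤ → ℂ) (z : ℂ) :
    stripSeries l a (z + 2 * Real.pi * I) = cexp (2 * Real.pi * I * l) * stripSeries l a z := by
  rw [stripSeries, stripSeries, Complex.exp_periodic z, mul_sub, ← tsum_mul_left]
  have h1 : cexp (l * (z + 2 * Real.pi * I)) = cexp (2 * Real.pi * I * l) * cexp (l * z) := by
    rw [← Complex.exp_add]
    congr 1
    ring
  have h2 (k : ℤ) : cexp (((k : ℂ) + l) * (z + 2 * Real.pi * I)) =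
      cexp (2 * Real.pi * I * l) * cexp (((k : ℂ) + l) * z) := by
    rw [← Complex.exp_add, Complex.exp_eq_exp_iff_exists_int]
    exact ⟨k, by ring⟩
  rw [h1]
  simp only [h2]
  congr 1
  · ring
  · exact tsum_congr fun k => by ring

lemma exp_eq_one_mem_periodLattice (τ : ℍ) {z : ℂ} (h : cexp z = 1) : z ∈ periodLattice τ :=
  mem_periodLattice_of_exp_eq (m := 0) (by simpa using h)

lemma IsLambertCoeff.differentiableAt_stripSeries {τ : ℍ} {θ ε : ℂ} {l : ℝ} {a : ℤ → ℂ}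
    (ha : IsLambertCoeff τ θ l ε a) (hθ : ‖θ‖ = 1) {z : ℂ} (hz : |z.re| < 2 * Real.pi * τ.im)
    (h1 : cexp z ≠ 1) : DifferentiableAt ℂ (stripSeries l a) z := by
  obtain ⟨C, hC⟩ := ha.exists_norm_sub_le hθ
  have hopen : IsOpen {z : ℂ | |z.re| < 2 * Real.pi * τ.im} :=
    isOpen_lt Complex.continuous_re.abs continuous_const
  have h := (differentiableOn_tsum_mul_cexp l hC).differentiableAt (hopen.mem_nhds hz)
  unfold stripSeries
  refine DifferentiableAt.sub (DifferentiableAt.neg (DifferentiableAt.div (by fun_prop)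
    (by fun_prop) (sub_ne_zero.2 h1.symm))) h

lemma IsLambertCoeff.tendsto_mul_stripSeries {τ : ℍ} {θ ε : ℂ} {l : ℝ} {a : ℤ → ℂ}
    (ha : IsLambertCoeff τ θ l ε a) (hθ : ‖θ‖ = 1) :
    Tendsto (fun z => z * stripSeries l a z) (𝓝[≠] 0) (𝓝 1) := by
  obtain ⟨C, hC⟩ := ha.exists_norm_sub_le hθ
  have hopen : IsOpen {z : ℂ | |z.re| < 2 * Real.pi * τ.im} :=
    isOpen_lt Complex.continuous_re.abs continuous_const
  have h := ((differentiableOn_tsum_mul_cexp l hC).differentiableAt (hopen.mem_nhds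
    (show |(0 : ℂ).re| < _ by simpa using two_pi_mul_im_pos τ))).continuousAt
  have h1 := ((continuousAt_id.mul h).tendsto).mono_left (nhdsWithin_le_nhds (s := {(0 : ℂ)}ᶜ))
  have hd : HasDerivAt (fun z : ℂ => 1 - cexp z) (-1) 0 := by
    simpa using (Complex.hasDerivAt_exp 0).const_sub 1
  have h2 := (hasDerivAt_iff_tendsto_slope.1 hd).inv₀ (by norm_num)
  have h3 : Tendsto (fun z : ℂ => cexp (l * z)) (𝓝[≠] 0) (𝓝 1) := by
    have hc : Continuous fun z : ℂ => cexp (l * z) := by fun_prop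
    simpa using (hc.tendsto 0).mono_left (nhdsWithin_le_nhds (s := {(0 : ℂ)}ᶜ))
  have h4 := ((h3.mul h2).neg).sub h1
  simp only [id, Pi.mul_apply, zero_mul, sub_zero] at h4
  norm_num at h4
  refine h4.congr fun z => ?_
  rw [stripSeries, slope_def_field]
  simp only [Complex.exp_zero, sub_self, sub_zero, inv_div]
  ring

/-- Comparison of the series with a meromorphic function which has the same periodicity and the same
principal part at the origin. -/
theorem IsLambertCoeff.exists_hasSum {τ : ℍ} {θ ε : ℂ} {l : ℝ} {a : ℤ → ℂ}
    (ha : IsLambertCoeff τ θ l ε a) (hθ : ‖θ‖ = 1) {F : ℂ → ℂ}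
    (hclosed : IsClosed (periodLattice τ))
    (hF : DifferentiableOn ℂ F (periodLattice τ)ᶜ)
    (hF1 : ∀ z, F (z + 2 * Real.pi * I) = cexp (2 * Real.pi * I * l) * F z)
    (hF2 : ∀ z ∉ periodLattice τ, F (z + 2 * Real.pi * I * τ) = θ * (F z - ε * cexp (l * z)))
    (hF0 : Tendsto (fun z => z * F z) (𝓝[≠] 0) (𝓝 1)) :
    ∃ c, c = cexp (2 * Real.pi * I * l) * c ∧ c = θ * c ∧ ∀ z : ℂ, -(2 * Real.pi * τ.im) < z.re →
      z.re < 0 → HasSum (fun k : ℤ => a k * cexp (((k : ℂ) + l) * z)) (-(F z + c)) := by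
  have hT := two_pi_mul_im_pos τ
  set D₀ : ℂ → ℂ := fun z => stripSeries l a z - F z with hD₀
  have hbox {z : ℂ} (hz : z ∈ periodBox τ) : |z.re| < 2 * Real.pi * τ.im := by
    rw [re_eq_tauCoord τ, abs_mul, abs_neg, abs_of_pos hT]
    nlinarith [hz.2]
  have hdiff {z : ℂ} (hz : |z.re| < 2 * Real.pi * τ.im) (hz' : z ∉ periodLattice τ) :
      DifferentiableAt ℂ D₀ z :=
    (ha.differentiableAt_stripSeries hθ hz fun h => hz' (exp_eq_one_mem_periodLattice τ h)).sub
      (hF.differentiableAt (hclosed.isOpen_compl.mem_nhds hz'))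
  -- The origin is the only lattice point in the box. Both functions have a simple pole there with
  -- residue `1`, so the singularity of the difference is removable.
  set D : ℂ → ℂ := Function.update D₀ 0 (limUnder (𝓝[≠] 0) D₀) with hD
  have hDne {z : ℂ} (hz : z ≠ 0) : D z = stripSeries l a z - F z := Function.update_of_ne hz _ _
  have hDdiff : DifferentiableOn ℂ D (periodBox τ) := by
    refine Complex.differentiableOn_update_limUnder_of_isLittleO
      ((isOpen_periodBox τ).mem_nhds (zero_mem_periodBox τ)) ?_ ?_
    · intro z hz
      exact (hdiff (hbox hz.1) fun h =>
        hz.2 (eq_zero_of_mem_periodBox hz.1 h)).differentiableWithinAt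
    · rw [Asymptotics.isLittleO_iff_tendsto']
      · have h1 := (ha.tendsto_mul_stripSeries hθ).sub hF0
        have h2 : Tendsto (fun z : ℂ => z * D₀ 0) (𝓝[≠] 0) (𝓝 0) := by
          have hc : Continuous fun z : ℂ => z * D₀ 0 := by fun_prop
          simpa using (hc.tendsto 0).mono_left (nhdsWithin_le_nhds (s := {(0 : ℂ)}ᶜ))
        have h3 := h1.sub h2
        rw [sub_self, sub_zero] at h3
        refine h3.congr fun z => ?_
        rw [sub_zero, div_inv_eq_mul, hD₀]
        ring
      · filter_upwards [self_mem_nhdsWithin] with z hz h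
        rw [sub_zero] at h
        exact absurd (inv_eq_zero.1 h) hz
  have hshift1 {z : ℂ} (hz : z ∈ periodBox τ) (hz' : z + 2 * Real.pi * I ∈ periodBox τ) :
      D (z + 2 * Real.pi * I) = cexp (2 * Real.pi * I * l) * D z := by
    have hc := coords_add_two_pi_I τ z
    have hz1 := hz'.1
    rw [hc.1] at hz1
    -- When both points lie in the open box, neither is the origin, so the filled-in value plays no
    -- role.
    have hneg : oneCoord τ z < 0 := by linarith [(abs_lt.1 hz1).2]
    have hpos : 0 < oneCoord τ z + 1 := by linarith [(abs_lt.1 hz.1).1]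
    have h0 : oneCoord τ 0 = 0 := by simp [oneCoord, tauCoord]
    rw [hDne, hDne, stripSeries_add_two_pi_I, hF1]
    · ring
    · rintro rfl
      exact hneg.ne h0
    · intro h
      rw [← hc.1, h, h0] at hpos
      exact lt_irrefl _ hpos
  have hshift2 {z : ℂ} (hz : z ∈ periodBox τ) (hz' : z + 2 * Real.pi * I * τ ∈ periodBox τ) :
      D (z + 2 * Real.pi * I * τ) = θ * D z := by
    have hc := coords_add_tau τ z
    have hz1 := hz'.2
    rw [hc.2] at hz1
    have hneg : tauCoord τ z < 0 := by linarith [(abs_lt.1 hz1).2]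
    have hpos : 0 < tauCoord τ z + 1 := by linarith [(abs_lt.1 hz.2).1]
    have h0 : tauCoord τ 0 = 0 := by simp [tauCoord]
    have hz0 : z ≠ 0 := by
      rintro rfl
      exact hneg.ne h0
    rw [hDne, hDne hz0, ha.stripSeries_add_tau hθ (by rw [re_eq_tauCoord τ]; nlinarith)
      (by rw [re_eq_tauCoord τ]; nlinarith), hF2 z fun h => hz0 (eq_zero_of_mem_periodBox hz h)]
    · ring
    · intro h
      rw [← hc.2, h, h0] at hpos
      exact lt_irrefl _ hpos
  obtain ⟨c, hc⟩ := exists_eq_const_of_norm_periodic hDdiff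
    (fun z hz hz' => by
      rw [hshift1 hz hz', norm_mul, Complex.norm_exp]
      simp)
    (fun z hz hz' => by rw [hshift2 hz hz', norm_mul, hθ, one_mul])
  have hmem (s t : ℝ) (hs : |s| < 1) (ht : |t| < 1) :
      2 * Real.pi * I * ((s : ℂ) + t * τ) ∈ periodBox τ :=
    ⟨by rwa [oneCoord_mk], by rwa [tauCoord_mk]⟩
  refine ⟨c, ?_, ?_, fun z hz1 hz2 => ?_⟩
  -- Two points of the box that differ by a period show that the constant satisfies the multiplier
  -- relation.
  · have m1 := hmem (-(1 / 2)) (1 / 2) (by norm_num) (by norm_num)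
    have m2 := hmem (1 / 2) (1 / 2) (by norm_num) (by norm_num)
    have e : 2 * Real.pi * I * (((1 / 2 : ℝ) : ℂ) + (1 / 2 : ℝ) * τ) =
        2 * Real.pi * I * (((-(1 / 2) : ℝ) : ℂ) + (1 / 2 : ℝ) * τ) + 2 * Real.pi * I := by
      push_cast
      ring
    rw [e] at m2
    have := hshift1 m1 m2
    rwa [hc _ m1, hc _ m2] at this
  · have m1 := hmem (1 / 2) (-(1 / 2)) (by norm_num) (by norm_num)
    have m2 := hmem (1 / 2) (1 / 2) (by norm_num) (by norm_num)
    have e : 2 * Real.pi * I * (((1 / 2 : ℝ) : ℂ) + (1 / 2 : ℝ) * τ) =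
        2 * Real.pi * I * (((1 / 2 : ℝ) : ℂ) + (-(1 / 2) : ℝ) * τ) + 2 * Real.pi * I * τ := by
      push_cast
      ring
    rw [e] at m2
    have := hshift2 m1 m2
    rwa [hc _ m1, hc _ m2] at this
  · have hstrip : IsOpen {z : ℂ | -(2 * Real.pi * τ.im) < z.re ∧ z.re < 0} :=
      (isOpen_lt continuous_const Complex.continuous_re).inter
        (isOpen_lt Complex.continuous_re continuous_const)
    have hconv : Convex ℝ {z : ℂ | -(2 * Real.pi * τ.im) < z.re ∧ z.re < 0} :=
      (convex_halfSpace_re_gt _).inter (convex_halfSpace_re_lt _)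
    have hnl {z : ℂ} (hz : -(2 * Real.pi * τ.im) < z.re ∧ z.re < 0) : z ∉ periodLattice τ := by
      rintro ⟨k, m, hkm⟩
      have h1 := tauCoord_mk τ k m
      simp only [ofReal_intCast] at h1
      rw [← hkm] at h1
      have h2 := re_eq_tauCoord τ z
      rw [h1] at h2
      have h3 : (0 : ℝ) < m := by
        by_contra h
        nlinarith [hz.2, not_lt.1 h]
      have h4 : (m : ℝ) < 1 := by
        by_contra h
        nlinarith [hz.1, not_lt.1 h]
      have h5 : (0 : ℤ) < m := by exact_mod_cast h3
      have h6 : m < (1 : ℤ) := by exact_mod_cast h4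
      omega
    -- Constancy is known only on the bounded box; the identity theorem extends it to the whole
    -- strip of convergence.
    have hDan : AnalyticOnNhd ℂ D₀ {z : ℂ | -(2 * Real.pi * τ.im) < z.re ∧ z.re < 0} := by
      refine DifferentiableOn.analyticOnNhd (fun z hz => ?_) hstrip
      exact (hdiff (abs_lt.2 ⟨hz.1, hz.2.trans hT⟩) (hnl hz)).differentiableWithinAt
    have hre0 : (2 * Real.pi * I * (((0 : ℝ) : ℂ) + (1 / 2 : ℝ) * τ)).re = -(Real.pi * τ.im) := by
      simp
      ring
    have h0 : 2 * Real.pi * I * (((0 : ℝ) : ℂ) + (1 / 2 : ℝ) * τ) ∈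
        {z : ℂ | -(2 * Real.pi * τ.im) < z.re ∧ z.re < 0} := by
      constructor
      · rw [hre0]; linarith
      · rw [hre0]; linarith
    have hev : D₀ =ᶠ[𝓝 (2 * Real.pi * I * (((0 : ℝ) : ℂ) + (1 / 2 : ℝ) * τ))] fun _ => c := by
      filter_upwards [(isOpen_periodBox τ).mem_nhds (hmem 0 (1 / 2) (by norm_num) (by norm_num)),
        hstrip.mem_nhds h0] with w hw hw'
      have hw0 : w ≠ 0 := by
        rintro rfl
        simp at hw'
      rw [← hc w hw, hDne hw0]
    have := hDan.eqOn_of_preconnected_of_eventuallyEq analyticOnNhd_const hconv.isPreconnected h0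
      hev (show z ∈ _ from ⟨hz1, hz2⟩)
    have h2 : stripSeries l a z = F z + c := by linear_combination this
    rw [← h2]
    exact ha.hasSum_of_re_neg hθ hz1 hz2

/-! ### Identification of the deformed Weierstrass functions -/

lemma isClosed_periodLattice (τ : ℍ) : IsClosed (periodLattice τ) := by
  have : periodLattice τ = (fun z => thetaOdd z τ) ⁻¹' {0} := by
    ext z
    exact (thetaOdd_eq_zero_iff τ z).symm
  rw [this]
  exact isClosed_singleton.preimage (differentiable_thetaOdd τ).continuous

lemma countable_periodLattice (τ : ℍ) : (periodLattice τ).Countable := by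
  refine (Set.countable_range fun p : ℤ × ℤ =>
    2 * (Real.pi : ℂ) * I * ((p.1 : ℂ) + (p.2 : ℂ) * τ)).mono ?_
  rintro z ⟨k, m, rfl⟩
  exact ⟨(k, m), rfl⟩

lemma dense_thetaOdd_ne_zero (τ : ℍ) : Dense {z | thetaOdd z τ ≠ 0} := by
  have : {z | thetaOdd z τ ≠ 0} = (periodLattice τ)ᶜ := by
    ext z
    exact not_congr (thetaOdd_eq_zero_iff τ z)
  rw [this]
  exact (countable_periodLattice τ).dense_compl ℝ

lemma mem_seriesDomain_iff (τ : ℍ) (z : ℂ) :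
    z ∈ seriesDomain τ ↔ -(2 * Real.pi * τ.im) < z.re ∧ z.re < 0 := by
  have h := norm_cexp_tau_mul τ 1
  simp only [ofReal_one, mul_one] at h
  rw [seriesDomain, Set.mem_ofPred_eq, h, Complex.norm_exp, Real.exp_lt_exp, Real.exp_lt_one_iff]

lemma pi_I_tau_notMem (τ : ℍ) :
    2 * Real.pi * I * (((0 : ℝ) : ℂ) + (1 / 2 : ℝ) * τ) ∉ periodLattice τ := by
  rintro ⟨k, m, h⟩
  have h1 := tauCoord_mk τ k m
  simp only [ofReal_intCast] at h1
  rw [← h, tauCoord_mk] at h1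
  have h2 : (2 * m : ℝ) = 1 := by linarith
  have h3 : 2 * m = 1 := by exact_mod_cast h2
  omega

/-- Uniqueness of the analytic continuation. -/
theorem deformedP1_eq {θ φ : ℂ} {τ : ℍ} {f : ℂ → ℂ} (hf : IsDeformedP1 θ φ τ f) {z : ℂ}
    (hz : z ∉ periodLattice τ) : deformedP1 θ φ z τ = f z := by
  have hex : ∃ f, IsDeformedP1 θ φ τ f := ⟨f, hf⟩
  have hopen := (isClosed_periodLattice τ).isOpen_compl
  have hconn : IsPreconnected (periodLattice τ)ᶜ :=
    ((countable_periodLattice τ).isConnected_compl_of_one_lt_rank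
      (by rw [Complex.rank_real_complex]; exact Cardinal.one_lt_two)).isPreconnected
  have hre0 : (2 * Real.pi * I * (((0 : ℝ) : ℂ) + (1 / 2 : ℝ) * τ)).re = -(Real.pi * τ.im) := by
    simp
    ring
  have hT := two_pi_mul_im_pos τ
  have h0 : 2 * Real.pi * I * (((0 : ℝ) : ℂ) + (1 / 2 : ℝ) * τ) ∈ seriesDomain τ := by
    rw [mem_seriesDomain_iff, hre0]
    constructor <;> linarith
  have hsd : IsOpen (seriesDomain τ) :=
    (isOpen_lt continuous_const Complex.continuous_exp.norm).inter
      (isOpen_lt Complex.continuous_exp.norm continuous_const)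
  have hev : hex.choose =ᶠ[𝓝 (2 * Real.pi * I * (((0 : ℝ) : ℂ) + (1 / 2 : ℝ) * τ))] f := by
    filter_upwards [hsd.mem_nhds h0] with w hw
    rw [hex.choose_spec.2 w hw, hf.2 w hw]
  rw [deformedP1, dif_pos hex]
  exact (hex.choose_spec.1.analyticOnNhd hopen).eqOn_of_preconnected_of_eventuallyEq
    (hf.1.analyticOnNhd hopen) hconn (pi_I_tau_notMem τ) hev hz

/-- The integers, as exponents of the series with `φ = exp (2πi l)`. -/
def exponentEquiv (l : ℝ) (φ : ℂ) (hφ : φ = cexp (2 * Real.pi * I * l)) :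
    ℤ ≃ {n : ℝ // cexp (2 * Real.pi * I * n) = φ} :=
  Equiv.ofBijective (fun k => ⟨k + l, by
    rw [hφ, Complex.exp_eq_exp_iff_exists_int]
    exact ⟨k, by push_cast; ring⟩⟩) <| by
  constructor
  · intro k m h
    have := congrArg Subtype.val h
    simpa using this
  · rintro ⟨n, hn⟩
    rw [hφ, Complex.exp_eq_exp_iff_exists_int] at hn
    obtain ⟨k, hk⟩ := hn
    refine ⟨k, Subtype.ext ?_⟩
    have h2 : 2 * Real.pi * I * (n : ℂ) = 2 * Real.pi * I * ((k + l : ℝ) : ℂ) := by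
      rw [hk]
      push_cast
      ring
    exact (Complex.ofReal_injective (mul_left_cancel₀ Complex.two_pi_I_ne_zero h2)).symm

open Classical in
lemma deformedP1Series_eq {θ φ : ℂ} (l : ℝ) (hφ : φ = cexp (2 * Real.pi * I * l)) (τ : ℍ)
    {a : ℤ → ℂ} (ha : ∀ k : ℤ, a k = if (k + l : ℝ) = 0 ∧ (θ, φ) = (1, 1) then 0 else
      (1 - θ⁻¹ * cexp (2 * Real.pi * I * τ * (k + l : ℝ)))⁻¹) (z : ℂ) :
    deformedP1Series θ φ z τ = -∑' k : ℤ, a k * cexp (((k : ℂ) + l) * z) := by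
  rw [deformedP1Series, ← (exponentEquiv l φ hφ).tsum_eq]
  congr 1
  refine tsum_congr fun k => ?_
  have hk : ((exponentEquiv l φ hφ k : {n : ℝ // cexp (2 * Real.pi * I * n) = φ}) : ℝ) = k + l := rfl
  rw [hk, ha]
  split_ifs
  · rw [zero_mul]
  · rw [div_eq_mul_inv, mul_comm]
    congr 2
    push_cast
    ring

lemma tendsto_div_thetaOdd (τ : ℍ) {g : ℂ → ℂ} (hg : ContinuousAt g 0) :
    Tendsto (fun z => z * (g z / thetaOdd z τ)) (𝓝[≠] 0)
      (𝓝 (g 0 * (I * ModularForm.eta τ ^ 3)⁻¹)) := by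
  have hη : I * ModularForm.eta τ ^ 3 ≠ 0 :=
    mul_ne_zero I_ne_zero (pow_ne_zero _ (ModularForm.eta_ne_zero τ.2))
  have h1 := (hasDerivAt_iff_tendsto_slope.1 (hasDerivAt_thetaOdd_zero τ)).inv₀ hη
  refine ((hg.tendsto.mono_left (nhdsWithin_le_nhds (s := {(0 : ℂ)}ᶜ))).mul h1).congr fun z => ?_
  rw [slope_def_field, thetaOdd_zero, sub_zero, sub_zero, inv_div]
  ring

lemma one_sub_inv_mul_cexp_ne_zero {τ : ℍ} {θ : ℂ} (hθ : ‖θ‖ = 1) {x : ℝ}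
    (h : x ≠ 0 ∨ θ ≠ 1) : 1 - θ⁻¹ * cexp (2 * Real.pi * I * τ * x) ≠ 0 := by
  intro h0
  have h1 : θ⁻¹ * cexp (2 * Real.pi * I * τ * x) = 1 := by linear_combination -h0
  have h2 := congrArg norm h1
  rw [norm_mul, norm_inv, hθ, norm_cexp_tau_mul, norm_one, inv_one, one_mul,
    Real.exp_eq_one_iff, neg_eq_zero] at h2
  have hx : x = 0 := (mul_eq_zero.1 h2).resolve_left (two_pi_mul_im_pos τ).ne'
  refine h.elim (fun h => h hx) fun h => h ?_
  rw [hx, ofReal_zero, mul_zero, Complex.exp_zero, mul_one] at h1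
  exact inv_eq_one.1 h1

/-- By comparison of coordinates, a shift in the lattice would make `α` and `β` integers. -/
lemma charShift_notMem {τ : ℍ} {α β : ℝ} (h : (cexp (-(2 * Real.pi * I * α)),
    cexp (-(2 * Real.pi * I * β))) ≠ (1, 1)) : charShift α β τ ∉ periodLattice τ := by
  rintro ⟨k, m, hkm⟩
  refine h ?_
  have e : charShift α β τ = 2 * Real.pi * I * ((α : ℂ) + ((-β : ℝ) : ℂ) * τ) := by
    rw [charShift]
    push_cast
    ring
  have h1 := tauCoord_mk τ k m
  have h2 := oneCoord_mk τ k m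
  simp only [ofReal_intCast] at h1 h2
  rw [← hkm, e] at h1 h2
  rw [tauCoord_mk] at h1
  rw [oneCoord_mk] at h2
  have hβ : β = ((-m : ℤ) : ℝ) := by push_cast; linarith
  rw [Prod.mk.injEq]
  constructor
  · rw [h2, Complex.exp_eq_one_iff]
    exact ⟨-k, by push_cast; ring⟩
  · rw [hβ, Complex.exp_eq_one_iff]
    exact ⟨m, by push_cast; ring⟩

lemma thetaOdd_ne_zero_iff (τ : ℍ) (z : ℂ) : thetaOdd z τ ≠ 0 ↔ z ∉ periodLattice τ :=
  not_congr (thetaOdd_eq_zero_iff τ z)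

/-- The deformed Weierstrass function with nontrivial characters as a theta quotient. -/
theorem deformedP1_eq_theta_quotient {τ : ℍ} {α β : ℝ} {θ φ : ℂ}
    (hθ : θ = cexp (-(2 * Real.pi * I * α))) (hφ : φ = cexp (-(2 * Real.pi * I * β)))
    (h : (θ, φ) ≠ (1, 1)) {z : ℂ} (hz : z ∉ periodLattice τ) :
    deformedP1 θ φ z τ = I * ModularForm.eta τ ^ 3 * thetaChar (1 / 2 - β) (1 / 2 + α) z τ /
      (thetaChar (1 / 2 - β) (1 / 2 + α) 0 τ * thetaOdd z τ) := by
  have hη : I * ModularForm.eta τ ^ 3 ≠ 0 :=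
    mul_ne_zero I_ne_zero (pow_ne_zero _ (ModularForm.eta_ne_zero τ.2))
  have hθ1 : ‖θ‖ = 1 := by rw [hθ, Complex.norm_exp]; simp
  have hφ' : φ = cexp (2 * Real.pi * I * (-β : ℝ)) := by
    rw [hφ]
    congr 1
    push_cast
    ring
  have h0 : thetaChar (1 / 2 - β) (1 / 2 + α) 0 τ ≠ 0 := by
    rw [thetaChar_eq_thetaOdd_shift, zero_add]
    refine mul_ne_zero (Complex.exp_ne_zero _) (mul_ne_zero (Complex.exp_ne_zero _) ?_)
    rw [thetaOdd_ne_zero_iff]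
    rw [hθ, hφ] at h
    exact charShift_notMem h
  have ha : IsLambertCoeff τ θ (-β) 0
      fun k => (1 - θ⁻¹ * cexp (2 * Real.pi * I * τ * (k + -β : ℝ)))⁻¹ := by
    intro k
    rw [ite_self, sub_zero]
    refine inv_mul_cancel₀ (one_sub_inv_mul_cexp_ne_zero hθ1 ?_)
    by_contra! hc
    refine h (Prod.ext hc.2 ?_)
    have hβ : β = (k : ℝ) := by linarith [hc.1]
    rw [hφ, hβ, Complex.exp_eq_one_iff]
    exact ⟨-k, by push_cast; ring⟩
  set F : ℂ → ℂ := fun z => I * ModularForm.eta τ ^ 3 * thetaChar (1 / 2 - β) (1 / 2 + α) z τ /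
      (thetaChar (1 / 2 - β) (1 / 2 + α) 0 τ * thetaOdd z τ) with hF
  have hdiff : DifferentiableOn ℂ F (periodLattice τ)ᶜ := by
    refine DifferentiableOn.div ((differentiable_thetaChar _ _ τ).const_mul _).differentiableOn
      ((differentiable_thetaOdd τ).const_mul _).differentiableOn fun z hz => ?_
    exact mul_ne_zero h0 ((thetaOdd_ne_zero_iff τ z).2 hz)
  have hF1 : ∀ z, F (z + 2 * Real.pi * I) = cexp (2 * Real.pi * I * (-β : ℝ)) * F z := by
    intro z
    have e : cexp (2 * Real.pi * I * ((1 / 2 - β : ℝ) : ℂ)) =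
        -cexp (2 * Real.pi * I * ((-β : ℝ) : ℂ)) := by
      rw [← neg_one_mul, ← Complex.exp_pi_mul_I, ← Complex.exp_add]
      congr 1
      push_cast
      ring
    simp only [hF]
    rw [thetaChar_add_two_pi_I, thetaOdd_add_two_pi_I, e, mul_neg, neg_mul, mul_neg, neg_div_neg_eq]
    ring
  have hF2 : ∀ z ∉ periodLattice τ,
      F (z + 2 * Real.pi * I * τ) = θ * (F z - 0 * cexp ((-β : ℝ) * z)) := by
    intro z hz
    have hz' := (thetaOdd_ne_zero_iff τ z).2 hz
    have e : cexp (-(I * Real.pi * τ) - z - 2 * Real.pi * I * ((1 / 2 + α : ℝ) : ℂ)) =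
        -cexp (-(I * Real.pi * τ) - z) * θ := by
      have e2 : cexp (2 * Real.pi * I * ((1 / 2 + α : ℝ) : ℂ)) =
          -cexp (2 * Real.pi * I * α) := by
        rw [← neg_one_mul, ← Complex.exp_pi_mul_I, ← Complex.exp_add]
        congr 1
        push_cast
        ring
      rw [hθ, Complex.exp_sub _ (_ * _), e2, Complex.exp_neg (2 * Real.pi * I * α), div_neg,
        div_eq_mul_inv, neg_mul]
    have hE := Complex.exp_ne_zero (-(I * Real.pi * τ) - z)
    simp only [hF]
    rw [thetaChar_add_tau, thetaOdd_add_tau, e]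
    field_simp
    ring
  have hF0 : Tendsto (fun z => z * F z) (𝓝[≠] 0) (𝓝 1) := by
    have := tendsto_div_thetaOdd τ (g := fun z => I * ModularForm.eta τ ^ 3 *
      thetaChar (1 / 2 - β) (1 / 2 + α) z τ / thetaChar (1 / 2 - β) (1 / 2 + α) 0 τ)
      (((differentiable_thetaChar _ _ τ).const_mul _).div_const _).continuous.continuousAt
    simp only [mul_div_assoc, div_self h0, mul_one] at this
    rw [mul_inv_cancel₀ hη] at this
    refine this.congr fun z => ?_
    simp only [hF]
    rw [div_mul_eq_div_div]
    ring
  obtain ⟨c, hc1, hc2, hc⟩ := ha.exists_hasSum hθ1 (isClosed_periodLattice τ) hdiff hF1 hF2 hF0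
  -- The constant is fixed by both multipliers `θ` and `φ`, one of which is not `1`.
  have hc0 : c = 0 := by
    by_contra hne
    refine h (Prod.ext ?_ ?_)
    · exact mul_right_cancel₀ hne (by rw [← hc2, one_mul])
    · rw [← hφ'] at hc1
      exact mul_right_cancel₀ hne (by rw [← hc1, one_mul])
  refine deformedP1_eq (f := F) ⟨hdiff, fun w hw => ?_⟩ hz
  rw [mem_seriesDomain_iff] at hw
  rw [deformedP1Series_eq (-β) hφ' τ (fun k => (if_neg fun hk => h hk.2).symm),
    (hc w hw.1 hw.2).tsum_eq, hc0, add_zero, neg_neg]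

/-- The deformed Weierstrass function with trivial characters as a logarithmic derivative. -/
theorem exists_deformedP1_one_eq (τ : ℍ) : ∃ c, ∀ z ∉ periodLattice τ,
    deformedP1 1 1 z τ = deriv (fun z => thetaOdd z τ) z / thetaOdd z τ + c := by
  have hη : I * ModularForm.eta τ ^ 3 ≠ 0 :=
    mul_ne_zero I_ne_zero (pow_ne_zero _ (ModularForm.eta_ne_zero τ.2))
  -- The omitted term is encoded by `a 0 = 0` and `ε = 1`: at `k = 0` the relation reads `0 = 1 -
  -- 1`.
  have ha : IsLambertCoeff τ 1 0 1 fun k => if k = 0 then 0 else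
      (1 - (1 : ℂ)⁻¹ * cexp (2 * Real.pi * I * τ * (k + 0 : ℝ)))⁻¹ := by
    intro k
    simp only
    split_ifs with hk
    · rw [zero_mul, sub_self]
    · rw [sub_zero]
      refine inv_mul_cancel₀ (one_sub_inv_mul_cexp_ne_zero norm_one (Or.inl ?_))
      rw [add_zero]
      exact_mod_cast hk
  have hθ := differentiable_thetaOdd τ
  set F : ℂ → ℂ := fun z => deriv (fun z => thetaOdd z τ) z / thetaOdd z τ with hF
  have hdiff : DifferentiableOn ℂ F (periodLattice τ)ᶜ :=
    DifferentiableOn.div hθ.deriv.differentiableOn hθ.differentiableOn fun z hz =>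
      (thetaOdd_ne_zero_iff τ z).2 hz
  have hF1 : ∀ z, F (z + 2 * Real.pi * I) = cexp (2 * Real.pi * I * (0 : ℝ)) * F z := by
    intro z
    have h1 : deriv (fun z => thetaOdd z τ) (z + 2 * Real.pi * I) =
        -deriv (fun z => thetaOdd z τ) z := by
      rw [← deriv_comp_add_const, ← deriv.fun_neg]
      congr 1
      funext w
      exact thetaOdd_add_two_pi_I w τ
    simp only [hF]
    rw [h1, thetaOdd_add_two_pi_I, neg_div_neg_eq]
    simp
  -- The logarithmic derivative of the factor `-exp (-πi τ - z)` of `ϑ₁` is `-1`, which matches `ε =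
  -- 1`.
  have hF2 : ∀ z ∉ periodLattice τ,
      F (z + 2 * Real.pi * I * τ) = 1 * (F z - 1 * cexp ((0 : ℝ) * z)) := by
    intro z hz
    have hz' := (thetaOdd_ne_zero_iff τ z).2 hz
    have hE := Complex.exp_ne_zero (-(I * Real.pi * τ) - z)
    have h1 : deriv (fun z => thetaOdd z τ) (z + 2 * Real.pi * I * τ) =
        -cexp (-(I * Real.pi * τ) - z) * (deriv (fun z => thetaOdd z τ) z - thetaOdd z τ) := by
      rw [← deriv_comp_add_const]
      have h2 : (fun w => thetaOdd (w + 2 * Real.pi * I * τ) τ) =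
          fun w => -cexp (-(I * Real.pi * τ) - w) * thetaOdd w τ := by
        funext w
        exact thetaOdd_add_tau w τ
      rw [h2]
      have h3 : HasDerivAt (fun w : ℂ => -cexp (-(I * Real.pi * τ) - w))
          (cexp (-(I * Real.pi * τ) - z)) z := by
        have := (((hasDerivAt_id z).const_sub (-(I * Real.pi * τ))).cexp).fun_neg
        simpa using this
      rw [(h3.fun_mul (hθ z).hasDerivAt).deriv]
      ring
    simp only [hF]
    rw [h1, thetaOdd_add_tau]
    simp only [ofReal_zero, zero_mul, Complex.exp_zero, mul_one, one_mul]
    field_simp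
  have hF0 : Tendsto (fun z => z * F z) (𝓝[≠] 0) (𝓝 1) := by
    have := tendsto_div_thetaOdd τ (g := deriv (fun z => thetaOdd z τ))
      hθ.deriv.continuous.continuousAt
    rwa [(hasDerivAt_thetaOdd_zero τ).deriv, mul_inv_cancel₀ hη] at this
  obtain ⟨c, -, -, hc⟩ := ha.exists_hasSum norm_one (isClosed_periodLattice τ) hdiff hF1 hF2 hF0
  refine ⟨c, fun z hz => deformedP1_eq (f := fun z => F z + c)
    ⟨hdiff.add_const c, fun w hw => ?_⟩ hz⟩
  rw [mem_seriesDomain_iff] at hw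
  rw [deformedP1Series_eq 0 (by simp) τ (fun k => ?_), (hc w hw.1 hw.2).tsum_eq, neg_neg]
  simp

/-! ### The determinant formulas -/

lemma prod_Ioi_neg_one {N : ℕ} : (∏ i : Fin N, ∏ _k ∈ Finset.Ioi i, (-1 : ℂ)) =
    (-1) ^ (N * (N - 1) / 2) := by
  simp only [Finset.prod_const, Fin.card_Ioi]
  rw [Finset.prod_pow_eq_pow_sum, Fin.sum_univ_eq_sum_range (fun i => N - 1 - i),
    Finset.sum_range_reflect (fun i => i), Finset.sum_range_id]

/-- The two quotients are inverse to each other except for the orientation of `y k - y i`; oddness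
of `ϑ₁` gives one sign for each pair. -/
lemma thetaFactor_mul_cauchyQuotient {N : ℕ} {x y : Fin N → ℂ} {τ : ℍ}
    (h : GenericPoints x y τ) :
    thetaFactor (fun _ => 1) (fun _ => 1) x y τ * cauchyQuotient (fun z => thetaOdd z τ) x y =
      (-1) ^ (N * (N - 1) / 2) := by
  have hy : ∏ i, ∏ k ∈ Finset.Ioi i, thetaOdd (y k - y i) τ =
      (-1) ^ (N * (N - 1) / 2) * ∏ i, ∏ k ∈ Finset.Ioi i, thetaOdd (y i - y k) τ := by
    rw [← prod_Ioi_neg_one, ← Finset.prod_mul_distrib]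
    refine Finset.prod_congr rfl fun i _ => ?_
    rw [← Finset.prod_mul_distrib]
    refine Finset.prod_congr rfl fun k _ => ?_
    rw [neg_one_mul, ← thetaOdd_neg, neg_sub]
  simp only [thetaFactor, cauchyQuotient, mul_one, pow_one, Finset.prod_mul_distrib]
  rw [hy]
  have h1 : ∏ i, ∏ j, thetaOdd (x i - y j) τ ≠ 0 :=
    Finset.prod_ne_zero_iff.2 fun i _ => Finset.prod_ne_zero_iff.2 fun j _ =>
      (thetaOdd_ne_zero_iff τ _).2 (h.1 i j)
  have h2 : ∏ i, ∏ k ∈ Finset.Ioi i, thetaOdd (x i - x k) τ ≠ 0 :=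
    Finset.prod_ne_zero_iff.2 fun i _ => Finset.prod_ne_zero_iff.2 fun j hj =>
      (thetaOdd_ne_zero_iff τ _).2 (h.2.1 i j (Finset.mem_Ioi.1 hj).ne)
  have h3 : ∏ i, ∏ k ∈ Finset.Ioi i, thetaOdd (y i - y k) τ ≠ 0 :=
    Finset.prod_ne_zero_iff.2 fun i _ => Finset.prod_ne_zero_iff.2 fun j hj =>
      (thetaOdd_ne_zero_iff τ _).2 (h.2.2 i j (Finset.mem_Ioi.1 hj).ne)
  field_simp

lemma isTrisecant_thetaOdd (τ : ℍ) : IsTrisecant fun z => thetaOdd z τ :=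
  fun w p r s t h => thetaOdd_trisecant τ w p r s t h

/-- The determinant of `P_N` for nontrivial characters. -/
theorem det_matrixP {N : ℕ} {τ : ℍ} {α β : ℝ} {θ φ : ℂ}
    (hθ : θ = cexp (-(2 * Real.pi * I * α))) (hφ : φ = cexp (-(2 * Real.pi * I * β)))
    (h : (θ, φ) ≠ (1, 1)) {x y : Fin N → ℂ} (hxy : GenericPoints x y τ) :
    thetaChar (1 / 2 - β) (1 / 2 + α) 0 τ * (matrixP θ φ x y τ).det =
      (I * ModularForm.eta τ ^ 3) ^ N * thetaChar (1 / 2 - β) (1 / 2 + α) (∑ i, (x i - y i)) τ *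
        cauchyQuotient (fun z => thetaOdd z τ) x y := by
  have hw : thetaOdd (charShift α β τ) τ ≠ 0 := by
    rw [hθ, hφ] at h
    exact (thetaOdd_ne_zero_iff τ _).2 (charShift_notMem h)
  have hM : matrixP θ φ x y τ = Matrix.of fun i j =>
      I * ModularForm.eta τ ^ 3 / thetaOdd (charShift α β τ) τ * cexp (-(β * x i)) *
        cexp (β * y j) * (Matrix.of fun i j => thetaOdd (x i - y j + charShift α β τ) τ /
          thetaOdd (x i - y j) τ) i j := by
    ext i j
    have h1 := (thetaOdd_ne_zero_iff τ _).2 (hxy.1 i j)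
    rw [matrixP, Matrix.of_apply, Matrix.of_apply, Matrix.of_apply,
      deformedP1_eq_theta_quotient hθ hφ h (hxy.1 i j), thetaChar_eq_thetaOdd_shift,
      thetaChar_eq_thetaOdd_shift, zero_add, mul_zero, neg_zero, Complex.exp_zero, one_mul,
      show -(β * (x i - y j)) = -(β * x i) + β * y j by ring, Complex.exp_add]
    have hC := Complex.exp_ne_zero
      (I * Real.pi * β ^ 2 * τ - β * (Real.pi * I + 2 * Real.pi * I * α))
    field_simp
  have hdet := det_frobenius (isTrisecant_thetaOdd τ) (differentiable_thetaOdd τ).continuous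
    (dense_thetaOdd_ne_zero τ) x y (fun i j => (thetaOdd_ne_zero_iff τ _).2 (hxy.1 i j))
    (charShift α β τ)
  have hexp : (∏ i, cexp (-(β * x i))) * ∏ i, cexp (β * y i) =
      cexp (-(β * ∑ i, (x i - y i))) := by
    rw [← Complex.exp_sum, ← Complex.exp_sum, ← Complex.exp_add, Finset.sum_sub_distrib, mul_sub,
      Finset.sum_neg_distrib, Finset.mul_sum, Finset.mul_sum]
    congr 1
    ring
  rw [hM, det_of_scaled, Fintype.card_fin, thetaChar_eq_thetaOdd_shift,
    thetaChar_eq_thetaOdd_shift, zero_add, mul_zero, neg_zero, Complex.exp_zero, one_mul, ← hexp,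
    div_pow]
  field_simp
  linear_combination (I * ModularForm.eta τ ^ 3) ^ N * (∏ i, cexp (-(β * x i))) * (∏ i, cexp (β * y i)) * hdet

/-- The determinant of `Q_N`. -/
theorem det_matrixQ {N : ℕ} {τ : ℍ} {x y : Fin (N + 1) → ℂ} (hxy : GenericPoints x y τ) :
    (matrixQ x y τ).det = -((I * ModularForm.eta τ ^ 3) ^ N * thetaOdd (∑ i, (x i - y i)) τ *
        cauchyQuotient (fun z => thetaOdd z τ) x y) := by
  have hη : I * ModularForm.eta τ ^ 3 ≠ 0 :=
    mul_ne_zero I_ne_zero (pow_ne_zero _ (ModularForm.eta_ne_zero τ.2))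
  obtain ⟨c, hc⟩ := exists_deformedP1_one_eq τ
  have hd := (hasDerivAt_thetaOdd_zero τ).deriv
  have hM : matrixP 1 1 x y τ = Matrix.of fun i j => (Matrix.of fun i j =>
      deriv (fun z => thetaOdd z τ) (x i - y j) / thetaOdd (x i - y j) τ) i j + c := by
    ext i j
    rw [matrixP, Matrix.of_apply, Matrix.of_apply, Matrix.of_apply, hc _ (hxy.1 i j)]
  rw [matrixQ, hM, det_bordered_add_const, det_bordered_logDeriv (isTrisecant_thetaOdd τ)
    (differentiable_thetaOdd τ) (dense_thetaOdd_ne_zero τ) (thetaOdd_zero τ) (by rwa [hd]) x y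
    (fun i j => (thetaOdd_ne_zero_iff τ _).2 (hxy.1 i j)), hd]

/-- The exponent `8` makes `i^8 = 1` and `(η³)^8 = η^24 = Δ` hold together. -/
lemma I_mul_eta_pow (τ : ℍ) (n : ℕ) :
    (I * ModularForm.eta τ ^ 3) ^ (8 * n) = ModularForm.discriminant τ ^ n := by
  rw [pow_mul, mul_pow, ← pow_mul, ModularForm.discriminant, show (8 : ℕ) = 4 * 2 from rfl,
    pow_mul I, Complex.I_pow_four, one_pow, one_mul]

end GenGarvan

end

/-! ### The sizes `8n` and `8n + 1` -/

theorem mainTheorem1 (τ : ℍ) (n : ℕ) :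
    (∀ (α β : ℝ) (θ φ : ℂ),
      θ = Complex.exp (-(2 * Real.pi * Complex.I * α)) →
      φ = Complex.exp (-(2 * Real.pi * Complex.I * β)) →
      (θ, φ) ≠ (1, 1) →
      ∀ x y : Fin (8 * n) → ℂ, GenGarvan.GenericPoints x y τ →
        GenGarvan.thetaChar (1 / 2 - β) (1 / 2 + α) (∑ i, (x i - y i)) τ ≠ 0 →
        ModularForm.discriminant τ ^ n =
          GenGarvan.thetaChar (1 / 2 - β) (1 / 2 + α) 0 τ *
              GenGarvan.thetaFactor (fun _ => 1) (fun _ => 1) x y τ /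
            GenGarvan.thetaChar (1 / 2 - β) (1 / 2 + α) (∑ i, (x i - y i)) τ *
          (GenGarvan.matrixP θ φ x y τ).det) ∧
    (∀ x y : Fin (8 * n + 1) → ℂ, GenGarvan.GenericPoints x y τ →
        GenGarvan.thetaOdd (∑ i, (x i - y i)) τ ≠ 0 →
        ModularForm.discriminant τ ^ n =
          -(GenGarvan.thetaFactor (fun _ => 1) (fun _ => 1) x y τ /
              GenGarvan.thetaOdd (∑ i, (x i - y i)) τ) *
          (GenGarvan.matrixQ x y τ).det) := by
  constructor
  · intro α β θ φ hθ hφ h x y hxy hne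
    have h1 := GenGarvan.det_matrixP hθ hφ h hxy
    have h2 := GenGarvan.thetaFactor_mul_cauchyQuotient hxy
    -- The exponent of the sign is even.
    have hs : 8 * n * (8 * n - 1) / 2 = 2 * (2 * n * (8 * n - 1)) := by
      rw [show 8 * n * (8 * n - 1) = 2 * (2 * (2 * n * (8 * n - 1))) by ring]
      exact Nat.mul_div_cancel_left _ two_pos
    rw [hs, pow_mul, neg_one_sq, one_pow] at h2
    rw [GenGarvan.I_mul_eta_pow] at h1
    rw [div_mul_eq_mul_div, eq_div_iff hne]
    linear_combination (-GenGarvan.thetaFactor (fun _ => 1) (fun _ => 1) x y τ) * h1 -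
      ModularForm.discriminant τ ^ n *
        GenGarvan.thetaChar (1 / 2 - β) (1 / 2 + α) (∑ i, (x i - y i)) τ * h2
  · intro x y hxy hne
    have h1 := GenGarvan.det_matrixQ hxy
    have h2 := GenGarvan.thetaFactor_mul_cauchyQuotient hxy
    -- Again the sign is trivial. The bordered determinant of size parameter `8n + 1` carries only
    -- the power `8n` of `i η³`.
    have hs : (8 * n + 1) * (8 * n + 1 - 1) / 2 = 2 * (2 * n * (8 * n + 1)) := by
      rw [Nat.add_sub_cancel, show (8 * n + 1) * (8 * n) = 2 * (2 * (2 * n * (8 * n + 1))) by ring]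
      exact Nat.mul_div_cancel_left _ two_pos
    rw [hs, pow_mul, neg_one_sq, one_pow] at h2
    rw [h1, GenGarvan.I_mul_eta_pow]
    field_simp
    linear_combination (-ModularForm.discriminant τ ^ n) * h2
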